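/- **Proposition 4.5.** Let $R$ be a commutative ring and let $(\mathcal X,\diamond,\mathbf 1)$ be an essentially small symmetric monoidal category enriched in $R$-modules, with $\diamond$ an $R$-bilinear functor. Let $\mathcal F$ be the category of $R$-linear functors from $\mathcal X$ to $R$-modules, with its symmetric monoidal structure given by the $R$-linear Day convolution $\otimes$ and the unit $I=\mathcal X(\mathbf 1,-)$. For $a\in F(x)$ and $b\in G(y)$ write $a\otimes b\in (F\otimes G)(x\diamond y)$ for their image under the universal pairing. For a monoid $A$ in $\mathcal F$ with product $\mu_A:A\otimes A\to A$, write $a\times b=\mu_A(a\otimes b)\in A(x\diamond y)$ for $a\in A(x)$, $b\in A(y)$, and let $\varepsilon\in A(\mathbf 1)$ be its identity element. The monoid $A$ is called tensor idempotent if $\mu_A$ is an isomorphism in $\mathcal F$. For variables $t_1,\dots,t_n$, let $A_n=A[t_1,\dots,t_n]$ be the monoid in $\mathcal F$ with $A_n(x)=A(x)[t_1,\dots,t_n]$, with functoriality applied to coefficients, with product $\bigl(\sum_i a_it^i\bigr)\times\bigl(\sum_j b_jt^j\bigr)=\sum_{i,j}(a_i\times b_j)t^{i+j}$, and with identity element the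 constant polynomial $\varepsilon$. Suppose that $A$ is a tensor idempotent commutative monoid in $\mathcal F$, let $n\ge 0$, and write $A_{2n}=A[u_1,\dots,u_n,v_1,\dots,v_n]$. Then there is an isomorphism of monoids in $\mathcal F$ $$\Phi: A_n\otimes A_n\;\longrightarrow\; A_{2n},\qquad \Phi(at^i\otimes bt^j)=(a\times b)\,u^iv^j$$ (for all objects $x,y$ of $\mathcal X$, all $a\in A(x)$, $b\in A(y)$ and all multi-indices $i,j$), and $\Phi$ maps the kernel of $\mu_{A_n}:A_n\otimes A_n\to A_n$ onto the ideal of $A_{2n}$ generated by the elements $u_1-v_1,\dots,u_n-v_n$ of $A_{2n}(\mathbf 1)$ (where $u_l$, $v_l$ stand for $\varepsilon u_l$, $\varepsilon v_l$), that is, onto the smallest $A_{2n}$-submodule of $A_{2n}$ containing them. -/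

import Mathlib

open CategoryTheory MonoidalCategory

universe w r v u

set_option linter.unusedSectionVars false

/-! ## The category of `R`-linear functors from `X` to `R`-modules -/

/-- An `R`-linear functor from an `R`-linear category `X` to the category of `R`-modules. -/
structure LinFun (R : Type r) [CommRing R] (X : Type u) [Category.{v} X] [Preadditive X]
    [Linear R X] where
  /-- the underlying functor -/
  toFunctor : X ⥤ ModuleCat.{w} R
  additive : toFunctor.Additive
  linear : toFunctor.Linear R

namespace LinFun

section Basic

variable {R : Type r} [CommRing R] {X : Type u} [Category.{v} X] [Preadditive X] [Linear R X]

/-- Morphisms of `R`-linear functors are the natural transformations. -/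
instance : Category (LinFun.{w} R X) :=
  inferInstanceAs (Category (InducedCategory (X ⥤ ModuleCat.{w} R) LinFun.toFunctor))

/-- The value `F(x)`. -/
abbrev val (F : LinFun.{w} R X) (x : X) : ModuleCat.{w} R := F.toFunctor.obj x

/-- The map `F(f) : F(x) → F(y)`. -/
def act (F : LinFun.{w} R X) {x y : X} (f : x ⟶ y) : F.val x →ₗ[R] F.val y :=
  (F.toFunctor.map f).hom

@[simp] lemma act_id (F : LinFun.{w} R X) (x : X) (a : F.val x) : F.act (𝟙 x) a = a := by
  simp [act]

lemma act_comp (F : LinFun.{w} R X) {x y z : X} (f : x ⟶ y) (g : y ⟶ z) (a : F.val x) :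
    F.act (f ≫ g) a = F.act g (F.act f a) := by
  simp [act]

lemma act_add (F : LinFun.{w} R X) {x y : X} (f g : x ⟶ y) (a : F.val x) :
    F.act (f + g) a = F.act f a + F.act g a := by
  have := F.additive
  simp [act, Functor.map_add]

lemma act_smul (F : LinFun.{w} R X) {x y : X} (c : R) (f : x ⟶ y) (a : F.val x) :
    F.act (c • f) a = c • F.act f a := by
  have := F.linear
  simp [act, Functor.map_smul]

/-- Build an `R`-linear functor from its action on elements. -/
def ofAct (obj : X → ModuleCat.{w} R) (m : ∀ {x y : X}, (x ⟶ y) → (obj x →ₗ[R] obj y))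
    (m_id : ∀ (x : X) (a : obj x), m (𝟙 x) a = a)
    (m_comp : ∀ {x y z : X} (f : x ⟶ y) (g : y ⟶ z) (a : obj x), m (f ≫ g) a = m g (m f a))
    (m_add : ∀ {x y : X} (f g : x ⟶ y) (a : obj x), m (f + g) a = m f a + m g a)
    (m_smul : ∀ {x y : X} (c : R) (f : x ⟶ y) (a : obj x), m (c • f) a = c • m f a) :
    LinFun.{w} R X where
  toFunctor :=
    { obj := obj
      map := fun f => ModuleCat.ofHom (m f)
      map_id := fun x => by ext a; simp [m_id]
      map_comp := fun f g => by ext a; simp [m_comp] }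
  additive := ⟨by intros; ext a; simp [m_add]⟩
  linear := ⟨by intros; ext a; simp [m_smul]⟩

/-- The component `F(x) → G(x)` of a morphism `F ⟶ G`. -/
def app {F G : LinFun.{w} R X} (φ : F ⟶ G) (x : X) : F.val x →ₗ[R] G.val x :=
  (φ.hom.app x).hom

@[simp] lemma app_id (F : LinFun.{w} R X) (x : X) (a : F.val x) : app (𝟙 F) x a = a := rfl

@[simp] lemma app_comp {F G H : LinFun.{w} R X} (φ : F ⟶ G) (ψ : G ⟶ H) (x : X)
    (a : F.val x) : app (φ ≫ ψ) x a = app ψ x (app φ x a) := rfl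

lemma app_act {F G : LinFun.{w} R X} (φ : F ⟶ G) {x y : X} (f : x ⟶ y) (a : F.val x) :
    app φ y (F.act f a) = G.act f (app φ x a) :=
  congrArg (fun k => k.hom a) (φ.hom.naturality f)

lemma hom_ext {F G : LinFun.{w} R X} {φ ψ : F ⟶ G}
    (h : ∀ (x : X) (a : F.val x), app φ x a = app ψ x a) : φ = ψ :=
  InducedCategory.hom_ext (NatTrans.ext (funext fun x => ModuleCat.hom_ext
    (LinearMap.ext fun a => h x a)))

/-- Build a morphism from its components. -/
def mkHom {F G : LinFun.{w} R X} (φ : ∀ x, F.val x →ₗ[R] G.val x)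
    (nat : ∀ {x y : X} (f : x ⟶ y) (a : F.val x), φ y (F.act f a) = G.act f (φ x a)) :
    F ⟶ G :=
  InducedCategory.homMk
    { app := fun x => ModuleCat.ofHom (φ x)
      naturality := fun x y f => by ext a; exact nat f a }

@[simp] lemma app_mkHom {F G : LinFun.{w} R X} (φ : ∀ x, F.val x →ₗ[R] G.val x) (nat) (x : X)
    (a : F.val x) : app (mkHom (F := F) (G := G) φ nat) x a = φ x a := rfl

end Basic

/-! ## The (linear) Day convolution -/

section Day

variable {R : Type r} [CommRing R] {X : Type u} [Category.{v} X] [Preadditive X] [Linear R X]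
  [MonoidalCategory X]

/-- A bilinear pairing `F(x) × G(y) → H(x ⊗ y)`, natural in `x` and `y`. -/
structure Pairing (F G H : LinFun.{w} R X) where
  /-- the components -/
  toFun (x y : X) : F.val x →ₗ[R] G.val y →ₗ[R] H.val (x ⊗ y)
  nat {x x' y y' : X} (f : x ⟶ x') (g : y ⟶ y') (a : F.val x) (b : G.val y) :
    toFun x' y' (F.act f a) (G.act g b) = H.act (f ⊗ₘ g) (toFun x y a b)

/-- Generators of `(F ⊗ G)(z)`: triples `(f, a, b)` with `f : x ⊗ y ⟶ z`, `a ∈ F(x)` and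
`b ∈ G(y)`. -/
structure DayGen (F G : LinFun.{w} R X) (z : X) where
  /-- the first object -/
  x : X
  /-- the second object -/
  y : X
  /-- the morphism -/
  f : x ⊗ y ⟶ z
  /-- the first element -/
  a : F.val x
  /-- the second element -/
  b : G.val y

/-- The formal basis element given by a triple. -/
noncomputable def gen (F G : LinFun.{w} R X) (z : X) {x y : X} (f : x ⊗ y ⟶ z) (a : F.val x)
    (b : G.val y) : DayGen F G z →₀ R :=
  Finsupp.single ⟨x, y, f, a, b⟩ 1

/-- The relations defining `(F ⊗ G)(z)`: linearity in each of the three variables, and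
compatibility with the functoriality of `F` and `G`. -/
inductive DayRel (F G : LinFun.{w} R X) (z : X) : (DayGen F G z →₀ R) → Prop
  | add_f {x y : X} (f f' : x ⊗ y ⟶ z) (a : F.val x) (b : G.val y) :
      DayRel F G z (gen F G z (f + f') a b - (gen F G z f a b + gen F G z f' a b))
  | smul_f {x y : X} (c : R) (f : x ⊗ y ⟶ z) (a : F.val x) (b : G.val y) :
      DayRel F G z (gen F G z (c • f) a b - c • gen F G z f a b)
  | add_a {x y : X} (f : x ⊗ y ⟶ z) (a a' : F.val x) (b : G.val y) :
      DayRel F G z (gen F G z f (a + a') b - (gen F G z f a b + gen F G z f a' b))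
  | smul_a {x y : X} (c : R) (f : x ⊗ y ⟶ z) (a : F.val x) (b : G.val y) :
      DayRel F G z (gen F G z f (c • a) b - c • gen F G z f a b)
  | add_b {x y : X} (f : x ⊗ y ⟶ z) (a : F.val x) (b b' : G.val y) :
      DayRel F G z (gen F G z f a (b + b') - (gen F G z f a b + gen F G z f a b'))
  | smul_b {x y : X} (c : R) (f : x ⊗ y ⟶ z) (a : F.val x) (b : G.val y) :
      DayRel F G z (gen F G z f a (c • b) - c • gen F G z f a b)
  | bal {x x' y y' : X} (g : x ⟶ x') (h : y ⟶ y') (f : x' ⊗ y' ⟶ z) (a : F.val x)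
      (b : G.val y) :
      DayRel F G z (gen F G z f (F.act g a) (G.act h b) - gen F G z ((g ⊗ₘ h) ≫ f) a b)

/-- The module `(F ⊗ G)(z)`, that is, the coend `∫^{x,y} X(x ⊗ y, z) ⊗_R F(x) ⊗_R G(y)`,
before it is brought back to the universe of the values of `F` and `G`. -/
abbrev DayRaw (F G : LinFun.{w} R X) (z : X) :=
  (DayGen F G z →₀ R) ⧸ Submodule.span R {p | DayRel F G z p}

/-- The class of a triple `(f, a, b)`. -/
noncomputable def cls (F G : LinFun.{w} R X) {z x y : X} (f : x ⊗ y ⟶ z) (a : F.val x)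
    (b : G.val y) : DayRaw F G z :=
  Submodule.Quotient.mk (gen F G z f a b)

section clsLemmas

variable {F G : LinFun.{w} R X} {z x y : X}

lemma mk_eq_of_rel {p q : DayGen F G z →₀ R} (h : DayRel F G z (p - q)) :
    (Submodule.Quotient.mk p : DayRaw F G z) = Submodule.Quotient.mk q :=
  (Submodule.Quotient.eq _).2 (Submodule.subset_span h)

lemma cls_add_f (f f' : x ⊗ y ⟶ z) (a : F.val x) (b : G.val y) :
    cls F G (f + f') a b = cls F G f a b + cls F G f' a b := mk_eq_of_rel (.add_f f f' a b)

lemma cls_smul_f (c : R) (f : x ⊗ y ⟶ z) (a : F.val x) (b : G.val y) :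
    cls F G (c • f) a b = c • cls F G f a b := mk_eq_of_rel (.smul_f c f a b)

lemma cls_add_a (f : x ⊗ y ⟶ z) (a a' : F.val x) (b : G.val y) :
    cls F G f (a + a') b = cls F G f a b + cls F G f a' b := mk_eq_of_rel (.add_a f a a' b)

lemma cls_smul_a (c : R) (f : x ⊗ y ⟶ z) (a : F.val x) (b : G.val y) :
    cls F G f (c • a) b = c • cls F G f a b := mk_eq_of_rel (.smul_a c f a b)

lemma cls_add_b (f : x ⊗ y ⟶ z) (a : F.val x) (b b' : G.val y) :
    cls F G f a (b + b') = cls F G f a b + cls F G f a b' := mk_eq_of_rel (.add_b f a b b')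

lemma cls_smul_b (c : R) (f : x ⊗ y ⟶ z) (a : F.val x) (b : G.val y) :
    cls F G f a (c • b) = c • cls F G f a b := mk_eq_of_rel (.smul_b c f a b)

lemma cls_bal {x' y' : X} (g : x ⟶ x') (h : y ⟶ y') (f : x' ⊗ y' ⟶ z) (a : F.val x)
    (b : G.val y) : cls F G f (F.act g a) (G.act h b) = cls F G ((g ⊗ₘ h) ≫ f) a b :=
  mk_eq_of_rel (.bal g h f a b)

lemma dayRaw_induction {P : DayRaw F G z → Prop} (zero : P 0)
    (add : ∀ s t, P s → P t → P (s + t))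
    (basic : ∀ {x y : X} (f : x ⊗ y ⟶ z) (a : F.val x) (b : G.val y), P (cls F G f a b))
    (t : DayRaw F G z) : P t := by
  obtain ⟨p, rfl⟩ := Submodule.Quotient.mk_surjective _ t
  induction p using Finsupp.induction_linear with
  | zero => exact zero
  | add p q hp hq => rw [Submodule.Quotient.mk_add]; exact add _ _ hp hq
  | single i c =>
    have : (Submodule.Quotient.mk (Finsupp.single i c) : DayRaw F G z) =
        cls F G i.f (c • i.a) i.b := by
      rw [cls_smul_a, cls, gen, ← Submodule.Quotient.mk_smul, Finsupp.smul_single, smul_eq_mul,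
        mul_one]
    rw [this]
    exact basic _ _ _

/-- A family of functions on triples that respects the relations extends to `DayRaw`. -/
noncomputable def rawLift {M : Type*} [AddCommGroup M] [Module R M]
    (L : DayGen F G z → M)
    (hL : ∀ p, DayRel F G z p → Finsupp.linearCombination R L p = 0) : DayRaw F G z →ₗ[R] M :=
  Submodule.liftQ _ (Finsupp.linearCombination R L)
    (Submodule.span_le.2 fun p hp => hL p hp)

@[simp] lemma rawLift_cls {M : Type*} [AddCommGroup M] [Module R M]
    (L : DayGen F G z → M) (hL) (f : x ⊗ y ⟶ z) (a : F.val x) (b : G.val y) :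
    rawLift (F := F) (G := G) L hL (cls F G f a b) = L ⟨x, y, f, a, b⟩ := by
  simp [rawLift, cls, gen]

lemma small_dayRaw [EssentiallySmall.{w} X] (F G : LinFun.{w} R X) (z : X) :
    Small.{w} (DayRaw F G z) := by
  let S := SmallModel.{w} X
  let e : X ≌ S := equivSmallModel X
  let T := Σ (s : S) (t : S), (Shrink.{w} ((e.inverse.obj s ⊗ e.inverse.obj t) ⟶ z)) ×
    F.val (e.inverse.obj s) × G.val (e.inverse.obj t)
  let q : List T → DayRaw F G z := fun l =>
    (l.map fun g => cls F G ((equivShrink _).symm g.2.2.1) g.2.2.2.1 g.2.2.2.2).sum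
  refine small_of_surjective (f := q) ?_
  intro t
  induction t using dayRaw_induction with
  | zero => exact ⟨[], rfl⟩
  | add s t hs ht =>
    obtain ⟨l, rfl⟩ := hs
    obtain ⟨m, rfl⟩ := ht
    exact ⟨l ++ m, by simp [q]⟩
  | @basic x y f a b =>
    let i := e.unitIso.app x
    let j := e.unitIso.app y
    refine ⟨[⟨e.functor.obj x, e.functor.obj y, equivShrink _ ((i.inv ⊗ₘ j.inv) ≫ f),
      F.act i.hom a, G.act j.hom b⟩], ?_⟩
    simp only [q, List.map_cons, List.map_nil, List.sum_cons, List.sum_nil, add_zero,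
      Equiv.symm_apply_apply]
    refine (cls_bal i.hom j.hom _ a b).trans ?_
    rw [tensorHom_comp_tensorHom_assoc, i.hom_inv_id, j.hom_inv_id, id_tensorHom_id,
      Category.id_comp]

end clsLemmas

/-- Functoriality of `DayRaw`. -/
noncomputable def rawMap (F G : LinFun.{w} R X) {z z' : X} (k : z ⟶ z') :
    DayRaw F G z →ₗ[R] DayRaw F G z' :=
  rawLift (fun g => cls F G (g.f ≫ k) g.a g.b) (by
    rintro p (_ | _ | _ | _ | _ | _ | _) <;>
    simp [gen, cls_add_f, cls_smul_f, cls_add_a, cls_smul_a, cls_add_b, cls_smul_b, cls_bal])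

@[simp] lemma rawMap_cls (F G : LinFun.{w} R X) {z z' x y : X} (k : z ⟶ z') (f : x ⊗ y ⟶ z)
    (a : F.val x) (b : G.val y) : rawMap F G k (cls F G f a b) = cls F G (f ≫ k) a b := by
  simp [rawMap]

variable [EssentiallySmall.{w} X]

instance (F G : LinFun.{w} R X) (z : X) : Small.{w} (DayRaw F G z) := small_dayRaw F G z

/-- Passage from `DayRaw` to its copy in the universe `w`. -/
noncomputable def shr (F G : LinFun.{w} R X) (z : X) :
    DayRaw F G z ≃ₗ[R] Shrink.{w} (DayRaw F G z) :=
  (Shrink.linearEquiv R _).symm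

/-- The tensor product `F ⊗ G` of linear functors (linear Day convolution). -/
noncomputable def day (F G : LinFun.{w} R X) : LinFun.{w} R X :=
  ofAct (fun z => ModuleCat.of R (Shrink.{w} (DayRaw F G z)))
    (fun k => (shr F G _).toLinearMap ∘ₗ rawMap F G k ∘ₗ (shr F G _).symm.toLinearMap)
    (fun x a => by
      obtain ⟨a, rfl⟩ := (shr F G x).surjective a
      induction a using dayRaw_induction with
      | zero => simp only [map_zero]
      | add s t hs ht => simp only [map_add, hs, ht]
      | basic f a b => simp)
    (fun f g a => by
      obtain ⟨a, rfl⟩ := (shr F G _).surjective a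
      induction a using dayRaw_induction with
      | zero => simp only [map_zero]
      | add s t hs ht => simp only [map_add, hs, ht]
      | basic f a b => simp)
    (fun f g a => by
      obtain ⟨a, rfl⟩ := (shr F G _).surjective a
      induction a using dayRaw_induction with
      | zero => simp only [map_zero, add_zero]
      | add s t hs ht => simp only [map_add, hs, ht]; abel
      | basic f a b => simp [cls_add_f])
    (fun c f a => by
      obtain ⟨a, rfl⟩ := (shr F G _).surjective a
      induction a using dayRaw_induction with
      | zero => simp only [map_zero, smul_zero]
      | add s t hs ht => simp only [map_add, hs, ht, smul_add]
      | basic f a b => simp [cls_smul_f])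

/-- The values of `F ⊗ G` are the modules `DayRaw`. -/
noncomputable def dayEquiv (F G : LinFun.{w} R X) (z : X) :
    DayRaw F G z ≃ₗ[R] (day F G).val z :=
  shr F G z

lemma act_dayEquiv (F G : LinFun.{w} R X) {z z' : X} (k : z ⟶ z') (t : DayRaw F G z) :
    (day F G).act k (dayEquiv F G z t) = dayEquiv F G z' (rawMap F G k t) := by
  change shr F G z' (rawMap F G k ((shr F G z).symm (shr F G z t))) = _
  rw [LinearEquiv.symm_apply_apply]
  rfl

/-- The universal pairing `F(x) × G(y) → (F ⊗ G)(x ⊗ y)`, `(a, b) ↦ a ⊗ b`. -/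
noncomputable def tmul (F G : LinFun.{w} R X) (x y : X) :
    F.val x →ₗ[R] G.val y →ₗ[R] (day F G).val (x ⊗ y) :=
  LinearMap.mk₂ R (fun a b => dayEquiv F G _ (cls F G (𝟙 (x ⊗ y)) a b))
    (fun a a' b => by simp [cls_add_a]) (fun c a b => by simp [cls_smul_a])
    (fun a b b' => by simp [cls_add_b]) (fun c a b => by simp [cls_smul_b])

lemma act_tmul_eq {F G : LinFun.{w} R X} {x y z : X} (f : x ⊗ y ⟶ z) (a : F.val x)
    (b : G.val y) :
    (day F G).act f (tmul F G x y a b) = dayEquiv F G _ (cls F G f a b) := by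
  simp [tmul, act_dayEquiv]

lemma tmul_nat {F G : LinFun.{w} R X} {x x' y y' : X} (f : x ⟶ x') (g : y ⟶ y') (a : F.val x)
    (b : G.val y) :
    tmul F G x' y' (F.act f a) (G.act g b) = (day F G).act (f ⊗ₘ g) (tmul F G x y a b) := by
  rw [act_tmul_eq]
  change dayEquiv F G _ (cls F G (𝟙 _) (F.act f a) (G.act g b)) = _
  rw [cls_bal, Category.comp_id]

lemma tmul_act_left {F G : LinFun.{w} R X} {x x' y : X} (f : x ⟶ x') (a : F.val x)
    (b : G.val y) :
    tmul F G x' y (F.act f a) b = (day F G).act (f ▷ y) (tmul F G x y a b) := by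
  have := tmul_nat f (𝟙 y) a b
  simpa using this

lemma tmul_act_right {F G : LinFun.{w} R X} {x y y' : X} (g : y ⟶ y') (a : F.val x)
    (b : G.val y) :
    tmul F G x y' a (G.act g b) = (day F G).act (x ◁ g) (tmul F G x y a b) := by
  have := tmul_nat (𝟙 x) g a b
  simpa using this

lemma day_induction {F G : LinFun.{w} R X} {z : X} {P : (day F G).val z → Prop} (zero : P 0)
    (add : ∀ s t, P s → P t → P (s + t))
    (basic : ∀ {x y : X} (f : x ⊗ y ⟶ z) (a : F.val x) (b : G.val y),
      P ((day F G).act f (tmul F G x y a b)))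
    (t : (day F G).val z) : P t := by
  obtain ⟨t, rfl⟩ := (dayEquiv F G z).surjective t
  induction t using dayRaw_induction with
  | zero => rw [map_zero]; exact zero
  | add s t hs ht => rw [map_add]; exact add _ _ hs ht
  | basic f a b => have := basic f a b; rwa [act_tmul_eq] at this

lemma day_ext {F G H : LinFun.{w} R X} {φ ψ : day F G ⟶ H}
    (h : ∀ (x y : X) (a : F.val x) (b : G.val y),
      app φ (x ⊗ y) (tmul F G x y a b) = app ψ (x ⊗ y) (tmul F G x y a b)) : φ = ψ := by
  refine hom_ext fun z t => ?_
  induction t using day_induction with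
  | zero => simp
  | add s t hs ht => rw [map_add, map_add, hs, ht]
  | basic f a b => rw [app_act, app_act, h]

/-- Two linear maps on `(F ⊗ G)(z)` agree if they agree on all `f_*(a ⊗ b)`. -/
lemma day_linear_ext {F G : LinFun.{w} R X} {z : X} {M : Type*} [AddCommGroup M] [Module R M]
    {l m : (day F G).val z →ₗ[R] M}
    (h : ∀ {x y : X} (f : x ⊗ y ⟶ z) (a : F.val x) (b : G.val y),
      l ((day F G).act f (tmul F G x y a b)) = m ((day F G).act f (tmul F G x y a b))) :
    l = m := by
  refine LinearMap.ext fun t => ?_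
  induction t using day_induction with
  | zero => simp
  | add s t hs ht => rw [map_add, map_add, hs, ht]
  | basic f a b => exact h f a b

/-- The components of `lift`. -/
noncomputable def rawLiftPairing {F G H : LinFun.{w} R X} (p : Pairing F G H) (z : X) :
    DayRaw F G z →ₗ[R] H.val z :=
  rawLift (fun g : DayGen F G z => H.act g.f (p.toFun g.x g.y g.a g.b)) (by
    rintro q (_ | _ | _ | _ | _ | _ | _) <;>
    simp [gen, act_add, act_smul, p.nat, act_comp])

/-- The morphism `F ⊗ G ⟶ H` corresponding to a pairing. -/
noncomputable def lift {F G H : LinFun.{w} R X} (p : Pairing F G H) : day F G ⟶ H :=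
  mkHom (fun z => rawLiftPairing p z ∘ₗ (dayEquiv F G z).symm.toLinearMap)
    (fun k a => by
      induction a using day_induction with
      | zero => simp only [map_zero]
      | add s t hs ht => simp only [map_add, hs, ht]
      | basic f a b =>
        rw [← act_comp, act_tmul_eq, act_tmul_eq]
        simp [act_comp, rawLiftPairing])

@[simp] lemma lift_tmul {F G H : LinFun.{w} R X} (p : Pairing F G H) (x y : X) (a : F.val x)
    (b : G.val y) : app (lift p) (x ⊗ y) (tmul F G x y a b) = p.toFun x y a b := by
  have := act_tmul_eq (𝟙 (x ⊗ y)) a b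
  rw [act_id] at this
  rw [this]
  simp [lift, rawLiftPairing]

end Day

/-! ## The symmetric monoidal structure -/

section Monoidal

variable {R : Type r} [CommRing R] {X : Type u} [Category.{v} X] [Preadditive X] [Linear R X]
  [MonoidalCategory X] [MonoidalPreadditive X] [MonoidalLinear R X] [EssentiallySmall.{w} X]

/-- The shifted functor `x ↦ P(x ⊗ z)`. -/
def shiftR (P : LinFun.{w} R X) (z : X) : LinFun.{w} R X :=
  ofAct (fun x => P.val (x ⊗ z)) (fun f => P.act (f ▷ z)) (by simp)
    (by simp [act_comp]) (by simp [act_add])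
    (fun c f a => by rw [MonoidalLinear.smul_whiskerRight, act_smul])

/-- The shifted functor `y ↦ P(x ⊗ y)`. -/
def shiftL (P : LinFun.{w} R X) (x : X) : LinFun.{w} R X :=
  ofAct (fun y => P.val (x ⊗ y)) (fun f => P.act (x ◁ f)) (by simp)
    (by simp [act_comp]) (by simp [act_add])
    (fun c f a => by rw [MonoidalLinear.whiskerLeft_smul, act_smul])

/-- A natural family of trilinear maps `F(x) × G(y) × H(z) → P((x ⊗ y) ⊗ z)` gives a pairing
of `F ⊗ G` and `H`. -/
noncomputable def pairLeft {F G H P : LinFun.{w} R X}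
    (θ : ∀ x y z, F.val x →ₗ[R] G.val y →ₗ[R] H.val z →ₗ[R] P.val ((x ⊗ y) ⊗ z))
    (nat : ∀ {x x' y y' z z' : X} (f : x ⟶ x') (g : y ⟶ y') (h : z ⟶ z') (a b c),
      θ x' y' z' (F.act f a) (G.act g b) (H.act h c) =
        P.act ((f ⊗ₘ g) ⊗ₘ h) (θ x y z a b c)) : Pairing (day F G) H P :=
  let T (z : X) (c : H.val z) : Pairing F G (shiftR P z) :=
    { toFun := fun x y => show F.val x →ₗ[R] G.val y →ₗ[R] P.val ((x ⊗ y) ⊗ z) from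
        LinearMap.mk₂ R (fun a b => θ x y z a b c) (by simp) (by simp) (by simp) (by simp)
      nat := fun f g a b => by
        have := nat f g (𝟙 z) a b c
        rw [act_id, tensorHom_id] at this
        exact this }
  have hT (x y z a b c) : app (lift (T z c)) (x ⊗ y) (tmul F G x y a b) = θ x y z a b c := by
    rw [lift_tmul]; rfl
  have key {x y z w' : X} (f : x ⊗ y ⟶ w') (a b c) :
      app (lift (T z c)) w' ((day F G).act f (tmul F G x y a b)) =
        P.act (f ▷ z) (θ x y z a b c) := by
    rw [app_act, hT]; rfl
  { toFun := fun w' z =>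
      LinearMap.mk₂ R (fun t c => (app (lift (T z c)) w' t : P.val (w' ⊗ z)))
        (fun t t' c => map_add _ _ _) (fun k t c => map_smul _ _ _)
        (fun t c c' => by
          induction t using day_induction with
          | zero => rw [map_zero, map_zero, map_zero]; exact (add_zero (0 : P.val _)).symm
          | add s t hs ht =>
            rw [map_add, map_add, map_add]
            refine (congrArg₂ (fun p q : P.val (w' ⊗ z) => p + q) hs ht).trans ?_
            exact add_add_add_comm (G := P.val (w' ⊗ z)) _ _ _ _
          | basic f a b => rw [key, key, key, map_add, map_add])
        (fun k t c => by
          induction t using day_induction with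
          | zero => rw [map_zero, map_zero]; exact (smul_zero (A := P.val _) k).symm
          | add s t hs ht =>
            rw [map_add, map_add]
            refine (congrArg₂ (fun p q : P.val (w' ⊗ z) => p + q) hs ht).trans ?_
            exact (smul_add (A := P.val (w' ⊗ z)) k _ _).symm
          | basic f a b => rw [key, key, map_smul, map_smul])
    nat := fun {w₁ w₂ z z'} f g t c => by
      change app (lift (T z' (H.act g c))) w₂ ((day F G).act f t) =
        P.act (f ⊗ₘ g) (app (lift (T z c)) w₁ t)
      induction t using day_induction with
      | zero =>
        rw [map_zero, map_zero, map_zero]; exact (map_zero (P.act (f ⊗ₘ g))).symm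
      | add s t hs ht =>
        rw [map_add, map_add, map_add]
        refine (congrArg₂ (fun p q : P.val (w₂ ⊗ z') => p + q) hs ht).trans ?_
        exact (map_add (P.act (f ⊗ₘ g)) _ _).symm
      | @basic x y k a b =>
        rw [← act_comp, key, key]
        have := nat (𝟙 x) (𝟙 y) g a b c
        rw [act_id, act_id] at this
        rw [this, ← act_comp, ← act_comp]
        refine congrArg (fun k => P.act k _) ?_
        rw [id_tensorHom_id, id_tensorHom, comp_whiskerRight, whisker_exchange_assoc,
          MonoidalCategory.tensorHom_def'] }

lemma pairLeft_tmul {F G H P : LinFun.{w} R X}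
    (θ : ∀ x y z, F.val x →ₗ[R] G.val y →ₗ[R] H.val z →ₗ[R] P.val ((x ⊗ y) ⊗ z)) (nat)
    (x y z : X) (a : F.val x) (b : G.val y) (c : H.val z) :
    (pairLeft θ nat).toFun (x ⊗ y) z (tmul F G x y a b) c = θ x y z a b c := by
  refine (lift_tmul _ x y a b).trans rfl

/-- A natural family of trilinear maps `F(x) × G(y) × H(z) → P(x ⊗ (y ⊗ z))` gives a pairing
of `F` and `G ⊗ H`. -/
noncomputable def pairRight {F G H P : LinFun.{w} R X}
    (θ : ∀ x y z, F.val x →ₗ[R] G.val y →ₗ[R] H.val z →ₗ[R] P.val (x ⊗ (y ⊗ z)))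
    (nat : ∀ {x x' y y' z z' : X} (f : x ⟶ x') (g : y ⟶ y') (h : z ⟶ z') (a b c),
      θ x' y' z' (F.act f a) (G.act g b) (H.act h c) =
        P.act (f ⊗ₘ (g ⊗ₘ h)) (θ x y z a b c)) : Pairing F (day G H) P :=
  let T (x : X) (a : F.val x) : Pairing G H (shiftL P x) :=
    { toFun := fun y z => show G.val y →ₗ[R] H.val z →ₗ[R] P.val (x ⊗ (y ⊗ z)) from
        LinearMap.mk₂ R (fun b c => θ x y z a b c) (by simp) (by simp) (by simp) (by simp)
      nat := fun g h b c => by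
        have := nat (𝟙 x) g h a b c
        rw [act_id, id_tensorHom] at this
        exact this }
  have hT (x y z a b c) : app (lift (T x a)) (y ⊗ z) (tmul G H y z b c) = θ x y z a b c := by
    rw [lift_tmul]; rfl
  have key {x y z w' : X} (f : y ⊗ z ⟶ w') (a b c) :
      app (lift (T x a)) w' ((day G H).act f (tmul G H y z b c)) =
        P.act (x ◁ f) (θ x y z a b c) := by
    rw [app_act, hT]; rfl
  { toFun := fun x w' =>
      LinearMap.mk₂ R (fun a t => (app (lift (T x a)) w' t : P.val (x ⊗ w')))
        (fun a a' t => by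
          induction t using day_induction with
          | zero => rw [map_zero, map_zero, map_zero]; exact (add_zero (0 : P.val _)).symm
          | add s t hs ht =>
            rw [map_add, map_add, map_add]
            refine (congrArg₂ (fun p q : P.val (x ⊗ w') => p + q) hs ht).trans ?_
            exact add_add_add_comm (G := P.val (x ⊗ w')) _ _ _ _
          | basic f b c =>
            rw [key, key, key, map_add, LinearMap.add_apply, LinearMap.add_apply, map_add])
        (fun k a t => by
          induction t using day_induction with
          | zero => rw [map_zero, map_zero]; exact (smul_zero (A := P.val _) k).symm
          | add s t hs ht =>
            rw [map_add, map_add]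
            refine (congrArg₂ (fun p q : P.val (x ⊗ w') => p + q) hs ht).trans ?_
            exact (smul_add (A := P.val (x ⊗ w')) k _ _).symm
          | basic f b c =>
            rw [key, key, map_smul, LinearMap.smul_apply, LinearMap.smul_apply, map_smul])
        (fun a t t' => map_add _ _ _) (fun k a t => map_smul _ _ _)
    nat := fun {x₁ x₂ w₁ w₂} f g a t => by
      change app (lift (T x₂ (F.act f a))) w₂ ((day G H).act g t) =
        P.act (f ⊗ₘ g) (app (lift (T x₁ a)) w₁ t)
      induction t using day_induction with
      | zero =>
        rw [map_zero, map_zero, map_zero]; exact (map_zero (P.act (f ⊗ₘ g))).symm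
      | add s t hs ht =>
        rw [map_add, map_add, map_add]
        refine (congrArg₂ (fun p q : P.val (x₂ ⊗ w₂) => p + q) hs ht).trans ?_
        exact (map_add (P.act (f ⊗ₘ g)) _ _).symm
      | @basic y z k b c =>
        rw [← act_comp, key, key]
        have := nat f (𝟙 y) (𝟙 z) a b c
        rw [act_id, act_id] at this
        rw [this, ← act_comp, ← act_comp]
        refine congrArg (fun k => P.act k _) ?_
        rw [id_tensorHom_id, tensorHom_id, MonoidalCategory.whiskerLeft_comp,
          ← whisker_exchange_assoc, MonoidalCategory.tensorHom_def] }

lemma pairRight_tmul {F G H P : LinFun.{w} R X}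
    (θ : ∀ x y z, F.val x →ₗ[R] G.val y →ₗ[R] H.val z →ₗ[R] P.val (x ⊗ (y ⊗ z))) (nat)
    (x y z : X) (a : F.val x) (b : G.val y) (c : H.val z) :
    (pairRight θ nat).toFun x (y ⊗ z) a (tmul G H y z b c) = θ x y z a b c := by
  refine (lift_tmul _ y z b c).trans rfl

lemma day_ext_left {F G H P : LinFun.{w} R X} {φ ψ : day (day F G) H ⟶ P}
    (h : ∀ (x y z : X) (a : F.val x) (b : G.val y) (c : H.val z),
      app φ _ (tmul (day F G) H (x ⊗ y) z (tmul F G x y a b) c) =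
        app ψ _ (tmul (day F G) H (x ⊗ y) z (tmul F G x y a b) c)) : φ = ψ := by
  refine day_ext fun w' z t c => ?_
  induction t using day_induction with
  | zero => simp only [map_zero, LinearMap.zero_apply]
  | add s t hs ht => simp only [map_add, LinearMap.add_apply, hs, ht]
  | basic f a b => rw [tmul_act_left, app_act, app_act, h]

lemma day_ext_right {F G H P : LinFun.{w} R X} {φ ψ : day F (day G H) ⟶ P}
    (h : ∀ (x y z : X) (a : F.val x) (b : G.val y) (c : H.val z),
      app φ _ (tmul F (day G H) x (y ⊗ z) a (tmul G H y z b c)) =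
        app ψ _ (tmul F (day G H) x (y ⊗ z) a (tmul G H y z b c))) : φ = ψ := by
  refine day_ext fun x w' a t => ?_
  induction t using day_induction with
  | zero => simp only [map_zero]
  | add s t hs ht => simp only [map_add, hs, ht]
  | basic f b c => rw [tmul_act_right, app_act, app_act, h]

lemma day_ext_left₃ {F G H K P : LinFun.{w} R X} {φ ψ : day (day (day F G) H) K ⟶ P}
    (h : ∀ (x y z t : X) (a : F.val x) (b : G.val y) (c : H.val z) (d : K.val t),
      app φ _ (tmul _ K _ t (tmul (day F G) H (x ⊗ y) z (tmul F G x y a b) c) d) =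
        app ψ _ (tmul _ K _ t (tmul (day F G) H (x ⊗ y) z (tmul F G x y a b) c) d)) :
    φ = ψ := by
  refine day_ext_left fun w' z t s c d => ?_
  induction s using day_induction with
  | zero => simp only [map_zero, LinearMap.zero_apply]
  | add s t hs ht => simp only [map_add, LinearMap.add_apply, hs, ht]
  | basic f a b => rw [tmul_act_left, tmul_act_left, app_act, app_act, h]

/-- The tensor product of two morphisms, `a ⊗ b ↦ φ(a) ⊗ ψ(b)`. -/
noncomputable def dayMap {F F' G G' : LinFun.{w} R X} (φ : F ⟶ F') (ψ : G ⟶ G') :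
    day F G ⟶ day F' G' :=
  lift
    { toFun := fun x y => (tmul F' G' x y).compl₁₂ (app φ x) (app ψ y)
      nat := fun f g a b => by simp [app_act, tmul_nat] }

@[simp] lemma dayMap_tmul {F F' G G' : LinFun.{w} R X} (φ : F ⟶ F') (ψ : G ⟶ G') (x y : X)
    (a : F.val x) (b : G.val y) :
    app (dayMap φ ψ) (x ⊗ y) (tmul F G x y a b) = tmul F' G' x y (app φ x a) (app ψ y b) := by
  simp [dayMap]

/-- The associator, `(a ⊗ b) ⊗ c ↦ a ⊗ (b ⊗ c)` up to the associator of `X`. -/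
noncomputable def assocHom (F G H : LinFun.{w} R X) :
    day (day F G) H ⟶ day F (day G H) :=
  lift (pairLeft
    (fun x y z => LinearMap.mk₂ R
      (fun a b => ((day F (day G H)).act (α_ x y z).inv) ∘ₗ
        (tmul F (day G H) x (y ⊗ z) a) ∘ₗ (tmul G H y z b))
      (fun a a' b => by ext; simp) (fun k a b => by ext; simp)
      (fun a b b' => by ext; simp) (fun k a b => by ext; simp))
    (fun f g h a b c => by simp [tmul_nat, ← act_comp]))

lemma assocHom_tmul (F G H : LinFun.{w} R X) (x y z : X) (a : F.val x) (b : G.val y)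
    (c : H.val z) :
    app (assocHom F G H) _ (tmul (day F G) H (x ⊗ y) z (tmul F G x y a b) c) =
      (day F (day G H)).act (α_ x y z).inv
        (tmul F (day G H) x (y ⊗ z) a (tmul G H y z b c)) := by
  rw [assocHom, lift_tmul, pairLeft_tmul]; rfl

/-- The inverse of the associator. -/
noncomputable def assocInv (F G H : LinFun.{w} R X) :
    day F (day G H) ⟶ day (day F G) H :=
  lift (pairRight
    (fun x y z => LinearMap.mk₂ R
      (fun a b => ((day (day F G) H).act (α_ x y z).hom) ∘ₗ
        (tmul (day F G) H (x ⊗ y) z (tmul F G x y a b)))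
      (fun a a' b => by ext; simp) (fun k a b => by ext; simp)
      (fun a b b' => by ext; simp) (fun k a b => by ext; simp))
    (fun f g h a b c => by simp [tmul_nat, ← act_comp]))

lemma assocInv_tmul (F G H : LinFun.{w} R X) (x y z : X) (a : F.val x) (b : G.val y)
    (c : H.val z) :
    app (assocInv F G H) _ (tmul F (day G H) x (y ⊗ z) a (tmul G H y z b c)) =
      (day (day F G) H).act (α_ x y z).hom
        (tmul (day F G) H (x ⊗ y) z (tmul F G x y a b) c) := by
  rw [assocInv, lift_tmul, pairRight_tmul]; rfl

/-- The unit object `I = X(𝟙, -)`. -/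
noncomputable def unitObj : LinFun.{w} R X :=
  ofAct (fun x => ModuleCat.of R (Shrink.{w} (𝟙_ X ⟶ x)))
    (fun {x y} f => ((Shrink.linearEquiv R (𝟙_ X ⟶ y)).symm.toLinearMap ∘ₗ
      Linear.rightComp R (𝟙_ X) f ∘ₗ (Shrink.linearEquiv R (𝟙_ X ⟶ x)).toLinearMap))
    (fun x a => by simp)
    (fun f g a => by simp)
    (fun f g a => by simp only [LinearMap.comp_apply, Linear.rightComp_apply,
      Preadditive.comp_add, map_add])
    (fun c f a => by simp only [LinearMap.comp_apply, Linear.rightComp_apply,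
      Linear.comp_smul, map_smul])

/-- The values of the unit object. -/
noncomputable def unitEquiv (x : X) :
    (𝟙_ X ⟶ x) ≃ₗ[R] (unitObj : LinFun.{w} R X).val x :=
  (Shrink.linearEquiv R _).symm

lemma act_unitEquiv {x y : X} (f : x ⟶ y) (g : 𝟙_ X ⟶ x) :
    (unitObj : LinFun.{w} R X).act f (unitEquiv x g) = unitEquiv y (g ≫ f) := by
  change (Shrink.linearEquiv R (𝟙_ X ⟶ y)).symm ((Shrink.linearEquiv R (𝟙_ X ⟶ x))
    ((Shrink.linearEquiv R (𝟙_ X ⟶ x)).symm g) ≫ f) = _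
  rw [LinearEquiv.apply_symm_apply]
  rfl

/-- The morphism `I ⟶ F` corresponding to an element of `F(𝟙)`. -/
noncomputable def ofElt (F : LinFun.{w} R X) (e : F.val (𝟙_ X)) : unitObj ⟶ F :=
  mkHom (fun x => (show (𝟙_ X ⟶ x) →ₗ[R] F.val x from
      { toFun := fun f => F.act f e
        map_add' := fun f g => act_add F f g e
        map_smul' := fun c f => act_smul F c f e }) ∘ₗ (unitEquiv x).symm.toLinearMap)
    (fun {x y} f a => by
      obtain ⟨g, rfl⟩ := (unitEquiv (R := R) x).surjective a
      rw [act_unitEquiv]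
      simp [act_comp])

@[simp] lemma ofElt_unitEquiv (F : LinFun.{w} R X) (e : F.val (𝟙_ X)) {x : X}
    (f : 𝟙_ X ⟶ x) : app (ofElt F e) x (unitEquiv x f) = F.act f e := by
  simp [ofElt]

lemma unitEquiv_eq {x : X} (f : 𝟙_ X ⟶ x) :
    unitEquiv x f = (unitObj : LinFun.{w} R X).act f (unitEquiv (𝟙_ X) (𝟙 (𝟙_ X))) := by
  rw [act_unitEquiv, Category.id_comp]

/-- The left unitor: `f ⊗ a` with `f : 𝟙 ⟶ x` and `a ∈ F(y)` goes to the image of `a` under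
`F(y) → F(𝟙 ⊗ y) → F(x ⊗ y)`. -/
noncomputable def leftUnitHom (F : LinFun.{w} R X) : day unitObj F ⟶ F :=
  lift
    { toFun := fun x y => LinearMap.mk₂ R
        (fun f a => F.act ((λ_ y).inv ≫ ((unitEquiv (R := R) x).symm f ▷ y)) a)
        (by simp [act_add]) (fun c f a => by
          rw [map_smul, MonoidalLinear.smul_whiskerRight, Linear.comp_smul, act_smul])
        (by simp) (by simp)
      nat := fun {x x' y y'} f g a b => by
        obtain ⟨a, rfl⟩ := (unitEquiv (R := R) x).surjective a
        rw [act_unitEquiv]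
        simp only [LinearMap.mk₂_apply, LinearEquiv.symm_apply_apply, ← act_comp]
        refine congrArg (fun k => F.act k _) ?_
        rw [leftUnitor_inv_naturality_assoc, comp_whiskerRight, whisker_exchange_assoc,
          MonoidalCategory.tensorHom_def']
        simp }

lemma leftUnitHom_tmul (F : LinFun.{w} R X) {x y : X} (f : 𝟙_ X ⟶ x) (a : F.val y) :
    app (leftUnitHom F) _ (tmul unitObj F x y (unitEquiv x f) a) =
      F.act ((λ_ y).inv ≫ f ▷ y) a := by
  simp [leftUnitHom]

/-- The right unitor. -/
noncomputable def rightUnitHom (F : LinFun.{w} R X) : day F unitObj ⟶ F :=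
  lift
    { toFun := fun x y => LinearMap.mk₂ R
        (fun a f => F.act ((ρ_ x).inv ≫ (x ◁ (unitEquiv (R := R) y).symm f)) a)
        (by simp) (by simp)
        (by simp [act_add]) (fun c f a => by
          rw [map_smul, MonoidalLinear.whiskerLeft_smul, Linear.comp_smul, act_smul])
      nat := fun {x x' y y'} f g a b => by
        obtain ⟨b, rfl⟩ := (unitEquiv (R := R) y).surjective b
        rw [act_unitEquiv]
        simp only [LinearMap.mk₂_apply, LinearEquiv.symm_apply_apply, ← act_comp]
        refine congrArg (fun k => F.act k _) ?_
        rw [rightUnitor_inv_naturality_assoc, MonoidalCategory.whiskerLeft_comp,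
          ← whisker_exchange_assoc, MonoidalCategory.tensorHom_def]
        simp }

lemma rightUnitHom_tmul (F : LinFun.{w} R X) {x y : X} (f : 𝟙_ X ⟶ y) (a : F.val x) :
    app (rightUnitHom F) _ (tmul F unitObj x y a (unitEquiv y f)) =
      F.act ((ρ_ x).inv ≫ x ◁ f) a := by
  simp [rightUnitHom]

/-- The associator. -/
noncomputable def assocIso (F G H : LinFun.{w} R X) :
    day (day F G) H ≅ day F (day G H) where
  hom := assocHom F G H
  inv := assocInv F G H
  hom_inv_id := day_ext_left fun x y z a b c => by
    simp [assocHom_tmul, assocInv_tmul, app_act, ← act_comp]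
  inv_hom_id := day_ext_right fun x y z a b c => by
    simp [assocHom_tmul, assocInv_tmul, app_act, ← act_comp]

/-- The left unitor. -/
noncomputable def leftUnitIso (F : LinFun.{w} R X) : day unitObj F ≅ F where
  hom := leftUnitHom F
  inv := mkHom (fun x => (day unitObj F).act (λ_ x).hom ∘ₗ
      tmul unitObj F (𝟙_ X) x (unitEquiv _ (𝟙 _)))
    (fun f a => by simp [tmul_act_right, ← act_comp])
  hom_inv_id := day_ext fun x y a b => by
    obtain ⟨f, rfl⟩ := (unitEquiv (R := R) x).surjective a
    simp only [app_comp, leftUnitHom_tmul, app_id, app_mkHom, LinearMap.comp_apply]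
    rw [unitEquiv_eq f, tmul_act_right, tmul_act_left, ← act_comp]
    congr 1
    simp
  inv_hom_id := hom_ext fun x a => by
    simp [app_act, leftUnitHom_tmul, ← act_comp]

/-- The right unitor. -/
noncomputable def rightUnitIso (F : LinFun.{w} R X) : day F unitObj ≅ F where
  hom := rightUnitHom F
  inv := mkHom (fun x => (day F unitObj).act (ρ_ x).hom ∘ₗ
      (tmul F unitObj x (𝟙_ X)).flip (unitEquiv _ (𝟙 _)))
    (fun f a => by simp [tmul_act_left, ← act_comp])
  hom_inv_id := day_ext fun x y a b => by
    obtain ⟨f, rfl⟩ := (unitEquiv (R := R) y).surjective b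
    simp only [app_comp, rightUnitHom_tmul, app_id, app_mkHom, LinearMap.comp_apply,
      LinearMap.flip_apply]
    rw [unitEquiv_eq f, tmul_act_right, tmul_act_left, ← act_comp]
    congr 1
    simp
  inv_hom_id := hom_ext fun x a => by
    simp [app_act, rightUnitHom_tmul, ← act_comp]

noncomputable instance : MonoidalCategoryStruct (LinFun.{w} R X) where
  tensorObj := day
  whiskerLeft F _ _ ψ := dayMap (𝟙 F) ψ
  whiskerRight φ G := dayMap φ (𝟙 G)
  tensorHom := dayMap
  tensorUnit := unitObj
  associator := assocIso
  leftUnitor := leftUnitIso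
  rightUnitor := rightUnitIso

/-- The tensor `a ⊗ b ∈ (F ⊗ G)(x ⊗ y)` of `a ∈ F(x)` and `b ∈ G(y)`. -/
noncomputable def tens (F G : LinFun.{w} R X) (x y : X) :
    F.val x →ₗ[R] G.val y →ₗ[R] (F ⊗ G).val (x ⊗ y) :=
  tmul F G x y

section tensLemmas

variable {F G H P F' G' : LinFun.{w} R X}

lemma tens_act_left {x x' y : X} (f : x ⟶ x') (a : F.val x) (b : G.val y) :
    tens F G x' y (F.act f a) b = (F ⊗ G).act (f ▷ y) (tens F G x y a b) :=
  tmul_act_left f a b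

lemma tens_act_right {x y y' : X} (g : y ⟶ y') (a : F.val x) (b : G.val y) :
    tens F G x y' a (G.act g b) = (F ⊗ G).act (x ◁ g) (tens F G x y a b) :=
  tmul_act_right g a b

lemma tensor_ext {φ ψ : F ⊗ G ⟶ P}
    (h : ∀ (x y : X) (a : F.val x) (b : G.val y),
      app φ (x ⊗ y) (tens F G x y a b) = app ψ (x ⊗ y) (tens F G x y a b)) : φ = ψ :=
  day_ext h

lemma tensor_ext_left {φ ψ : (F ⊗ G) ⊗ H ⟶ P}
    (h : ∀ (x y z : X) (a : F.val x) (b : G.val y) (c : H.val z),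
      app φ _ (tens (F ⊗ G) H (x ⊗ y) z (tens F G x y a b) c) =
        app ψ _ (tens (F ⊗ G) H (x ⊗ y) z (tens F G x y a b) c)) : φ = ψ :=
  day_ext_left h

lemma tensor_ext_right {φ ψ : F ⊗ (G ⊗ H) ⟶ P}
    (h : ∀ (x y z : X) (a : F.val x) (b : G.val y) (c : H.val z),
      app φ _ (tens F (G ⊗ H) x (y ⊗ z) a (tens G H y z b c)) =
        app ψ _ (tens F (G ⊗ H) x (y ⊗ z) a (tens G H y z b c))) : φ = ψ :=
  day_ext_right h

@[simp] lemma app_tensorHom (φ : F ⟶ F') (ψ : G ⟶ G') (x y : X) (a : F.val x)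
    (b : G.val y) :
    app (φ ⊗ₘ ψ) _ (tens F G x y a b) = tens F' G' x y (app φ x a) (app ψ y b) :=
  dayMap_tmul φ ψ x y a b

@[simp] lemma app_whiskerLeft (ψ : G ⟶ G') (x y : X) (a : F.val x) (b : G.val y) :
    app (F ◁ ψ) _ (tens F G x y a b) = tens F G' x y a (app ψ y b) :=
  dayMap_tmul (𝟙 F) ψ x y a b

@[simp] lemma app_whiskerRight (φ : F ⟶ F') (x y : X) (a : F.val x) (b : G.val y) :
    app (φ ▷ G) _ (tens F G x y a b) = tens F' G x y (app φ x a) b :=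
  dayMap_tmul φ (𝟙 G) x y a b

lemma app_associator_hom (x y z : X) (a : F.val x) (b : G.val y) (c : H.val z) :
    app (α_ F G H).hom _ (tens (F ⊗ G) H (x ⊗ y) z (tens F G x y a b) c) =
      (F ⊗ (G ⊗ H)).act (α_ x y z).inv (tens F (G ⊗ H) x (y ⊗ z) a (tens G H y z b c)) :=
  assocHom_tmul F G H x y z a b c

lemma app_associator_inv (x y z : X) (a : F.val x) (b : G.val y) (c : H.val z) :
    app (α_ F G H).inv _ (tens F (G ⊗ H) x (y ⊗ z) a (tens G H y z b c)) =
      ((F ⊗ G) ⊗ H).act (α_ x y z).hom (tens (F ⊗ G) H (x ⊗ y) z (tens F G x y a b) c) :=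
  assocInv_tmul F G H x y z a b c

/-- The element `f` of `I(x) = X(𝟙, x)`. -/
noncomputable def unitElt {x : X} (f : 𝟙_ X ⟶ x) : (𝟙_ (LinFun.{w} R X)).val x :=
  unitEquiv x f

lemma unitElt_surjective {x : X} (a : (𝟙_ (LinFun.{w} R X)).val x) :
    ∃ f : 𝟙_ X ⟶ x, a = unitElt f := by
  obtain ⟨f, hf⟩ := (unitEquiv (R := R) x).surjective a
  exact ⟨f, hf.symm⟩

lemma app_unitElt (φ : 𝟙_ (LinFun.{w} R X) ⟶ F) {x : X} (f : 𝟙_ X ⟶ x) :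
    app φ x (unitElt f) = F.act f (app φ _ (unitElt (𝟙 _))) := by
  rw [← app_act]
  exact congrArg (app φ x) (unitEquiv_eq f)

lemma app_leftUnitor {x y : X} (f : 𝟙_ X ⟶ x) (a : F.val y) :
    app (λ_ F).hom _ (tens (𝟙_ _) F x y (unitElt f) a) = F.act ((λ_ y).inv ≫ f ▷ y) a :=
  leftUnitHom_tmul F f a

lemma app_rightUnitor {x y : X} (f : 𝟙_ X ⟶ y) (a : F.val x) :
    app (ρ_ F).hom _ (tens F (𝟙_ _) x y a (unitElt f)) = F.act ((ρ_ x).inv ≫ x ◁ f) a :=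
  rightUnitHom_tmul F f a

end tensLemmas

noncomputable instance : MonoidalCategory (LinFun.{w} R X) where
  tensorHom_def f g := tensor_ext fun x y a b => by simp
  id_tensorHom_id F G := tensor_ext fun x y a b => by simp
  tensorHom_comp_tensorHom _ _ _ _ := tensor_ext fun x y a b => by simp
  whiskerLeft_id F G := tensor_ext fun x y a b => by simp
  id_whiskerRight F G := tensor_ext fun x y a b => by simp
  associator_naturality f g h := tensor_ext_left fun x y z a b c => by
    simp [app_associator_hom, app_act]
  leftUnitor_naturality f := tensor_ext fun x y a b => by
    obtain ⟨k, rfl⟩ := unitElt_surjective a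
    simp [app_leftUnitor, app_act]
  rightUnitor_naturality f := tensor_ext fun x y a b => by
    obtain ⟨k, rfl⟩ := unitElt_surjective b
    simp [app_rightUnitor, app_act]
  pentagon F G H K := day_ext_left₃ fun x y z t a b c d => by
    change app _ _ (tens _ K _ t (tens (F ⊗ G) H (x ⊗ y) z (tens F G x y a b) c) d) =
      app _ _ (tens _ K _ t (tens (F ⊗ G) H (x ⊗ y) z (tens F G x y a b) c) d)
    simp only [app_comp, app_whiskerRight, app_whiskerLeft, app_associator_hom, app_act,
      tens_act_left, tens_act_right, ← act_comp]
    congr 1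
    simp
  triangle F G := tensor_ext_left fun x y z a b c => by
    obtain ⟨k, rfl⟩ := unitElt_surjective b
    simp only [app_comp, app_whiskerRight, app_whiskerLeft, app_associator_hom, app_act,
      app_leftUnitor, app_rightUnitor, tens_act_left, tens_act_right, ← act_comp]
    congr 1
    simp

end Monoidal

section Braiding

variable {R : Type r} [CommRing R] {X : Type u} [Category.{v} X] [Preadditive X] [Linear R X]
  [MonoidalCategory X] [MonoidalPreadditive X] [MonoidalLinear R X] [SymmetricCategory X]
  [EssentiallySmall.{w} X]

/-- The morphism `F ⊗ G ⟶ H` corresponding to a pairing. -/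
noncomputable def liftTens {F G H : LinFun.{w} R X} (p : Pairing F G H) : F ⊗ G ⟶ H := lift p

@[simp] lemma app_liftTens {F G H : LinFun.{w} R X} (p : Pairing F G H) (x y : X)
    (a : F.val x) (b : G.val y) :
    app (liftTens p) (x ⊗ y) (tens F G x y a b) = p.toFun x y a b := lift_tmul p x y a b

/-- The symmetry `F ⊗ G ⟶ G ⊗ F`, `a ⊗ b ↦ b ⊗ a` up to the symmetry of `X`. -/
noncomputable def braid (F G : LinFun.{w} R X) : F ⊗ G ⟶ G ⊗ F :=
  liftTens
    { toFun := fun x y => LinearMap.mk₂ R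
        (fun a b => (G ⊗ F).act (β_ y x).hom (tens G F y x b a))
        (by simp) (by simp) (by simp) (by simp)
      nat := fun f g a b => by
        simp only [LinearMap.mk₂_apply, tens_act_left, tens_act_right, ← act_comp]
        refine congrArg (fun k => (G ⊗ F).act k _) ?_
        simp [MonoidalCategory.tensorHom_def, whisker_exchange] }

lemma app_braid (F G : LinFun.{w} R X) (x y : X) (a : F.val x) (b : G.val y) :
    app (braid F G) _ (tens F G x y a b) = (G ⊗ F).act (β_ y x).hom (tens G F y x b a) := by
  simp [braid]

lemma braid_braid (F G : LinFun.{w} R X) : braid F G ≫ braid G F = 𝟙 _ :=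
  tensor_ext fun x y a b => by simp [app_braid, app_act, ← act_comp]

noncomputable instance : SymmetricCategory (LinFun.{w} R X) where
  braiding F G := ⟨braid F G, braid G F, braid_braid F G, braid_braid G F⟩
  braiding_naturality_right F _ _ ψ := tensor_ext fun x y a b => by
    simp [app_braid, app_act]
  braiding_naturality_left φ G := tensor_ext fun x y a b => by
    simp [app_braid, app_act]
  hexagon_forward F G H := tensor_ext_left fun x y z a b c => by
    simp only [app_comp, app_whiskerRight, app_whiskerLeft, app_associator_hom, app_act,
      app_braid, tens_act_left, tens_act_right, ← act_comp]
    refine congrArg (fun k => (G ⊗ (H ⊗ F)).act k _) ?_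
    rw [← cancel_epi ((α_ y z x).hom)]
    simp
  hexagon_reverse F G H := tensor_ext_right fun x y z a b c => by
    simp only [app_comp, app_whiskerRight, app_whiskerLeft, app_associator_inv, app_act,
      app_braid, tens_act_left, tens_act_right, ← act_comp]
    refine congrArg (fun k => ((H ⊗ F) ⊗ G).act k _) ?_
    rw [← cancel_epi ((α_ z x y).inv)]
    simp
  symmetry F G := braid_braid F G

lemma app_braiding (F G : LinFun.{w} R X) (x y : X) (a : F.val x) (b : G.val y) :
    app (β_ F G).hom _ (tens F G x y a b) = (G ⊗ F).act (β_ y x).hom (tens G F y x b a) :=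
  app_braid F G x y a b

end Braiding

/-! ## Monoids on elements, polynomials, ideals -/

section Monoids

variable {R : Type r} [CommRing R] {X : Type u} [Category.{v} X] [Preadditive X] [Linear R X]
  [MonoidalCategory X] [MonoidalPreadditive X] [MonoidalLinear R X]
  [EssentiallySmall.{w} X]

open scoped MonObj

/-- The product `a × b = μ_A(a ⊗ b) ∈ A(x ⊗ y)` of `a ∈ A(x)` and `b ∈ A(y)` in a monoid. -/
noncomputable def prod (A : LinFun.{w} R X) [MonObj A] (x y : X) :
    A.val x →ₗ[R] A.val y →ₗ[R] A.val (x ⊗ y) :=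
  (tens A A x y).compr₂ (app μ[A] (x ⊗ y))

/-- The identity element `ε ∈ A(𝟙)` of a monoid. -/
noncomputable def unit (A : LinFun.{w} R X) [MonObj A] : A.val (𝟙_ X) :=
  app η[A] (𝟙_ X) (unitElt (𝟙 (𝟙_ X)))

section prodLemmas

variable (A : LinFun.{w} R X) [MonObj A]

lemma prod_eq {x y : X} (a : A.val x) (b : A.val y) :
    A.prod x y a b = app μ[A] (x ⊗ y) (tens A A x y a b) := rfl

lemma prod_nat {x x' y y' : X} (f : x ⟶ x') (g : y ⟶ y') (a : A.val x) (b : A.val y) :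
    A.prod x' y' (A.act f a) (A.act g b) = A.act (f ⊗ₘ g) (A.prod x y a b) := by
  simp only [prod_eq]
  rw [tens_act_left, tens_act_right, ← act_comp, ← MonoidalCategory.tensorHom_def', app_act]

lemma prod_assoc {x y z : X} (a : A.val x) (b : A.val y) (c : A.val z) :
    A.prod (x ⊗ y) z (A.prod x y a b) c =
      A.act (α_ x y z).inv (A.prod x (y ⊗ z) a (A.prod y z b c)) := by
  have := congrArg (fun k => app k _ (tens (A ⊗ A) A (x ⊗ y) z (tens A A x y a b) c))
    (MonObj.mul_assoc A)
  simp only [app_comp, app_whiskerRight, app_associator_hom, app_act, app_whiskerLeft] at this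
  exact this

lemma unit_prod {x : X} (a : A.val x) :
    A.prod (𝟙_ X) x A.unit a = A.act (λ_ x).inv a := by
  have := congrArg (fun k => app k _ (tens (𝟙_ _) A (𝟙_ X) x (unitElt (𝟙 _)) a))
    (MonObj.one_mul A)
  simp only [app_comp, app_whiskerRight, app_leftUnitor, id_whiskerRight,
    Category.comp_id] at this
  exact this

lemma prod_unit {x : X} (a : A.val x) :
    A.prod x (𝟙_ X) a A.unit = A.act (ρ_ x).inv a := by
  have := congrArg (fun k => app k _ (tens A (𝟙_ _) x (𝟙_ X) a (unitElt (𝟙 _))))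
    (MonObj.mul_one A)
  simp only [app_comp, app_whiskerLeft, app_rightUnitor, MonoidalCategory.whiskerLeft_id,
    Category.comp_id] at this
  exact this

end prodLemmas

/-- The functor of polynomials `F[t_s, s ∈ σ]`: its value at `x` is `F(x)[t_s, s ∈ σ]`, the
module of finitely supported families `(a_i)` of elements of `F(x)` indexed by multi-indices
`i : σ →₀ ℕ`, standing for `∑ a_i t^i`. -/
noncomputable def poly (σ : Type) (F : LinFun.{w} R X) : LinFun.{w} R X :=
  ofAct (fun x => ModuleCat.of R ((σ →₀ ℕ) →₀ F.val x))
    (fun f => Finsupp.mapRange.linearMap (F.act f))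
    (fun x p => Finsupp.ext fun i => act_id F x (p i))
    (fun f g p => Finsupp.ext fun i => act_comp F f g (p i))
    (fun f g p => Finsupp.ext fun i => act_add F f g (p i))
    (fun c f p => Finsupp.ext fun i => act_smul F c f (p i))

/-- The monomial `a t^i`. -/
noncomputable def monom {σ : Type} (F : LinFun.{w} R X) (x : X) (i : σ →₀ ℕ) :
    F.val x →ₗ[R] (poly σ F).val x :=
  Finsupp.lsingle i

lemma act_monom {σ : Type} (F : LinFun.{w} R X) {x y : X} (f : x ⟶ y) (i : σ →₀ ℕ)
    (a : F.val x) : (poly σ F).act f (monom F x i a) = monom F y i (F.act f a) :=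
  Finsupp.mapRange_single (hf := map_zero (F.act f))

lemma poly_induction {σ : Type} {F : LinFun.{w} R X} {x : X} {P : (poly σ F).val x → Prop}
    (zero : P 0) (add : ∀ p q, P p → P q → P (p + q)) (basic : ∀ i a, P (monom F x i a))
    (p : (poly σ F).val x) : P p :=
  Finsupp.induction_linear (motive := P) p zero add basic

/-- The product of polynomials, `(a t^i, b t^j) ↦ (a × b) t^(i + j)`. -/
noncomputable def polyProd (σ : Type) (A : LinFun.{w} R X) [MonObj A] (x y : X) :
    (poly σ A).val x →ₗ[R] (poly σ A).val y →ₗ[R] (poly σ A).val (x ⊗ y) :=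
  show ((σ →₀ ℕ) →₀ A.val x) →ₗ[R] ((σ →₀ ℕ) →₀ A.val y) →ₗ[R] (poly σ A).val (x ⊗ y) from
  Finsupp.lsum R fun i => LinearMap.flip (Finsupp.lsum R fun j =>
    LinearMap.flip ((A.prod x y).compr₂ (monom A (x ⊗ y) (i + j))))

lemma polyProd_monom (σ : Type) (A : LinFun.{w} R X) [MonObj A] {x y : X} (i j : σ →₀ ℕ)
    (a : A.val x) (b : A.val y) :
    polyProd σ A x y (monom A x i a) (monom A y j b) =
      monom A (x ⊗ y) (i + j) (A.prod x y a b) := by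
  change (Finsupp.lsum R fun i => LinearMap.flip (Finsupp.lsum R fun j =>
    LinearMap.flip ((A.prod x y).compr₂ (monom A (x ⊗ y) (i + j))))) (Finsupp.single i a)
      (Finsupp.single j b) = _
  simp

/-- Polynomials over a monoid form a monoid. -/
noncomputable instance (σ : Type) (A : LinFun.{w} R X) [MonObj A] : MonObj (poly σ A) where
  one := ofElt (poly σ A) (monom A (𝟙_ X) 0 A.unit)
  mul := lift
    { toFun := polyProd σ A
      nat := fun f g p q => by
        induction p using poly_induction with
        | zero => simp only [map_zero, LinearMap.zero_apply]
        | add p p' hp hp' => simp only [map_add, LinearMap.add_apply, hp, hp']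
        | basic i a =>
          induction q using poly_induction with
          | zero => simp only [map_zero]
          | add p p' hp hp' => simp only [map_add, hp, hp']
          | basic j b => simp only [act_monom, polyProd_monom, prod_nat] }
  one_mul := tensor_ext fun x y f p => by
    obtain ⟨f, rfl⟩ := unitElt_surjective f
    rw [app_comp, app_whiskerRight, app_leftUnitor]
    refine (lift_tmul _ _ _ _ _).trans ?_
    change polyProd σ A x y (app (ofElt _ _) x (unitEquiv x f)) p = _
    rw [ofElt_unitEquiv, act_monom]
    induction p using poly_induction with
    | zero => simp only [map_zero]
    | add p p' hp hp' => simp only [map_add, hp, hp']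
    | basic i a =>
      rw [polyProd_monom, zero_add, act_monom]
      have := prod_nat A f (𝟙 y) A.unit a
      rw [act_id, unit_prod, ← act_comp, tensorHom_id] at this
      rw [this]
  mul_one := tensor_ext fun x y p f => by
    obtain ⟨f, rfl⟩ := unitElt_surjective f
    rw [app_comp, app_whiskerLeft, app_rightUnitor]
    refine (lift_tmul _ _ _ _ _).trans ?_
    change polyProd σ A x y p (app (ofElt _ _) y (unitEquiv y f)) = _
    rw [ofElt_unitEquiv, act_monom]
    induction p using poly_induction with
    | zero => simp only [map_zero, LinearMap.zero_apply]
    | add p p' hp hp' => simp only [map_add, LinearMap.add_apply, hp, hp']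
    | basic i a =>
      rw [polyProd_monom, add_zero, act_monom]
      have := prod_nat A (𝟙 x) f a A.unit
      rw [act_id, prod_unit, ← act_comp, id_tensorHom] at this
      rw [this]
  mul_assoc := tensor_ext_left fun x y z p q s => by
    rw [app_comp, app_whiskerRight, app_comp, app_comp, app_associator_hom, app_act, app_act,
      app_whiskerLeft]
    refine (lift_tmul _ _ _ _ _).trans ?_
    refine Eq.trans ?_ (congrArg ((poly σ A).act (α_ x y z).inv) (lift_tmul _ _ _ _ _)).symm
    change polyProd σ A (x ⊗ y) z (app (lift _) (x ⊗ y) (tmul _ _ x y p q)) s =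
      (poly σ A).act (α_ x y z).inv
        (polyProd σ A x (y ⊗ z) p (app (lift _) (y ⊗ z) (tmul _ _ y z q s)))
    rw [lift_tmul, lift_tmul]
    change polyProd σ A (x ⊗ y) z (polyProd σ A x y p q) s =
      (poly σ A).act (α_ x y z).inv (polyProd σ A x (y ⊗ z) p (polyProd σ A y z q s))
    induction p using poly_induction with
    | zero => simp only [map_zero, LinearMap.zero_apply]
    | add p p' hp hp' => simp only [map_add, LinearMap.add_apply, hp, hp']
    | basic i a =>
      induction q using poly_induction with
      | zero => simp only [map_zero, LinearMap.zero_apply]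
      | add p p' hp hp' => simp only [map_add, LinearMap.add_apply, hp, hp']
      | basic j b =>
        induction s using poly_induction with
        | zero => simp only [map_zero]
        | add p p' hp hp' => simp only [map_add, hp, hp']
        | basic k c =>
          rw [polyProd_monom, polyProd_monom, polyProd_monom, polyProd_monom, act_monom,
            prod_assoc, add_assoc]

lemma prod_monom (σ : Type) (A : LinFun.{w} R X) [MonObj A] {x y : X} (i j : σ →₀ ℕ)
    (a : A.val x) (b : A.val y) :
    (poly σ A).prod x y (monom A x i a) (monom A y j b) =
      monom A (x ⊗ y) (i + j) (A.prod x y a b) :=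
  (lift_tmul _ _ _ _ _).trans (polyProd_monom σ A i j a b)

lemma unit_poly (σ : Type) (A : LinFun.{w} R X) [MonObj A] :
    (poly σ A).unit = monom A (𝟙_ X) 0 A.unit :=
  (ofElt_unitEquiv _ _ _).trans (act_id _ _ _)

/-- The variable `t_s`, as the element `ε t_s` of `A[t](𝟙)`. -/
noncomputable def var {σ : Type} (A : LinFun.{w} R X) [MonObj A] (s : σ) :
    (poly σ A).val (𝟙_ X) :=
  monom A (𝟙_ X) (Finsupp.single s 1) A.unit

/-- A subfunctor of a linear functor `F`. -/
@[ext]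
structure Sub (F : LinFun.{w} R X) where
  /-- the submodule of `F(x)` -/
  carrier (x : X) : Submodule R (F.val x)
  act_mem {x y : X} (f : x ⟶ y) {a : F.val x} : a ∈ carrier x → F.act f a ∈ carrier y

/-- The kernel of a morphism. -/
def Sub.ker {F G : LinFun.{w} R X} (φ : F ⟶ G) : Sub F where
  carrier x := LinearMap.ker (app φ x)
  act_mem f a h := by
    rw [LinearMap.mem_ker] at h ⊢
    rw [app_act, h, map_zero]

/-- The image of a subfunctor under a morphism. -/
def Sub.map {F G : LinFun.{w} R X} (φ : F ⟶ G) (S : Sub F) : Sub G where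
  carrier x := (S.carrier x).map (app φ x)
  act_mem f := by
    rintro _ ⟨a, h, rfl⟩
    exact ⟨_, S.act_mem f h, app_act φ f a⟩

/-- A subfunctor `S` of a monoid `A` is a (left) `A`-submodule of `A`. -/
def Sub.IsIdeal {A : LinFun.{w} R X} [MonObj A] (S : Sub A) : Prop :=
  ∀ ⦃x y : X⦄ (a : A.val x) ⦃s : A.val y⦄, s ∈ S.carrier y → A.prod x y a s ∈ S.carrier (x ⊗ y)

/-- The ideal `A⟨α⟩` generated by a family `α` of elements of `A(𝟙)`: the intersection of all
`A`-submodules of `A` that contain these elements. -/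
def Sub.span {J : Type} (A : LinFun.{w} R X) [MonObj A] (α : J → A.val (𝟙_ X)) : Sub A where
  carrier x := ⨅ (S : Sub A) (_ : S.IsIdeal) (_ : ∀ l, α l ∈ S.carrier (𝟙_ X)), S.carrier x
  act_mem f a h := by
    simp only [Submodule.mem_iInf] at h ⊢
    exact fun S h₁ h₂ => S.act_mem f (h S h₁ h₂)

end Monoids

end LinFun

open scoped MonObj

open scoped MonObj

/-! A polynomial object `A[t]` is the coproduct of copies `A t^i` of `A`, and Day convolution is
additive in each variable. So `A[u] ⊗ A[v]` is built from copies of `A ⊗ A` indexed by pairs `(i,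
j)`. A pair of multi-indices is the same as one multi-index on the disjoint union of the variables,
and on each copy `Φ` is `μ[A]` followed by the inclusion of `A u^i v^j`. Tensor idempotence inverts
it copy by copy (`polyMulIso`). Commutativity of `A` makes `Φ` multiplicative, through `(a × c) × (b
× d) = (a × b) × (c × d)` up to the symmetry (`mul_polyMul`).

For the kernel, let the fold be the substitution `u_l, v_l ↦ t_l`. Then `Φ` followed by the fold is
`μ` of `A[t]` (`polyMul_rename_fold`), so `Φ` carries the kernel of `μ` onto the kernel of the fold.
That kernel is an ideal containing every `u_l - v_l`. Conversely, modulo any ideal containing these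
differences, a polynomial `p` is congruent to the result of replacing each `v_l` by `u_l`, which
depends only on the fold of `p` and vanishes when the fold of `p` does (`ker_rename_fold_eq_span`).

That tensoring preserves coproducts is never stated as such. Its uniqueness half is replaced by
generating families (`IsGenerating.tensorHom`), which reduce identities of morphisms to monomials;
existence of the inverse only needs morphisms out of a single polynomial object (`polyDesc`). -/

namespace LinFun

/-! ### Generating families and their tensor products -/

section Generating

variable {R : Type r} [CommRing R] {X : Type u} [Category.{v} X] [Preadditive X] [Linear R X]

/-- A family of morphisms is generating if the values of its target are spanned by the images
of its members. -/
def IsGenerating {I : Type*} {F : I → LinFun.{w} R X} {G : LinFun.{w} R X}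
    (f : ∀ i, F i ⟶ G) : Prop :=
  ∀ (x : X) (P : G.val x → Prop), P 0 → (∀ p q, P p → P q → P (p + q)) →
    (∀ i a, P (app (f i) x a)) → ∀ p, P p

/-- Generating families are jointly epimorphic, because the locus where two morphisms agree contains
zero and is closed under addition. -/
lemma IsGenerating.hom_ext {I : Type*} {F : I → LinFun.{w} R X} {G H : LinFun.{w} R X}
    {f : ∀ i, F i ⟶ G} (hf : IsGenerating f) {φ ψ : G ⟶ H} (h : ∀ i, f i ≫ φ = f i ≫ ψ) :
    φ = ψ :=
  LinFun.hom_ext fun x a => hf x (fun a => app φ x a = app ψ x a) (by simp only [map_zero])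
    (fun p q hp hq => by simp only [map_add, hp, hq])
    (fun i a => by rw [← app_comp, ← app_comp, h]) a

variable [MonoidalCategory X] [MonoidalPreadditive X] [MonoidalLinear R X]
  [EssentiallySmall.{w} X]

/-- Every element of `(G ⊗ G')(z)` is a sum of elements `k_*(a ⊗ b)`. By bilinearity `a` and `b` may
be taken in the images of the two families. The lemma can be iterated, which yields the four-factor
case needed for multiplicativity. -/
lemma IsGenerating.tensorHom {I J : Type*} {F : I → LinFun.{w} R X} {F' : J → LinFun.{w} R X}
    {G G' : LinFun.{w} R X} {f : ∀ i, F i ⟶ G} {g : ∀ j, F' j ⟶ G'} (hf : IsGenerating f)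
    (hg : IsGenerating g) : IsGenerating (fun p : I × J => f p.1 ⊗ₘ g p.2) := by
  intro z P zero add basic t
  refine day_induction (F := G) (G := G') zero add (fun {x y} k a b => ?_) t
  change P ((G ⊗ G').act k (tens G G' x y a b))
  refine hf x (fun a => P ((G ⊗ G').act k (tens G G' x y a b))) ?_ ?_ ?_ a
  · simpa only [map_zero, LinearMap.zero_apply] using zero
  · intro p q hp hq
    simpa only [map_add, LinearMap.add_apply] using add _ _ hp hq
  · intro i a
    refine hg y (fun b => P ((G ⊗ G').act k (tens G G' x y (app (f i) x a) b))) ?_ ?_ ?_ b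
    · simpa only [map_zero] using zero
    · intro p q hp hq
      simpa only [map_add] using add _ _ hp hq
    · intro j b
      -- Naturality moves `k` inside: `k_*(f a ⊗ g b)` is the image under `f ⊗ g` of the single
      -- element `k_*(a ⊗ b)`.
      have := basic (i, j) ((F i ⊗ F' j).act k (tens _ _ x y a b))
      rwa [app_act, app_tensorHom] at this

end Generating

/-! ### Polynomial objects: monomials, substitution of variables, products and ideals -/

section Poly

variable {R : Type r} [CommRing R] {X : Type u} [Category.{v} X] [Preadditive X] [Linear R X]
  [MonoidalCategory X] [MonoidalPreadditive X] [MonoidalLinear R X] [EssentiallySmall.{w} X]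

/-- The morphism `F ⟶ F[t]`, `a ↦ a t^i`. -/
noncomputable def monomHom {σ : Type} (F : LinFun.{w} R X) (i : σ →₀ ℕ) : F ⟶ poly σ F :=
  mkHom (fun x => monom F x i) (fun f a => (act_monom F f i a).symm)

@[simp] lemma app_monomHom {σ : Type} (F : LinFun.{w} R X) (i : σ →₀ ℕ) (x : X)
    (a : F.val x) : app (monomHom F i) x a = monom F x i a := rfl

lemma isGenerating_monomHom (σ : Type) (F : LinFun.{w} R X) :
    IsGenerating (fun i : σ →₀ ℕ => monomHom F i) :=
  fun _ _ zero add basic p => poly_induction zero add basic p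

lemma poly_hom_ext {σ : Type} {F G : LinFun.{w} R X} {φ ψ : poly σ F ⟶ G}
    (h : ∀ i, monomHom F i ≫ φ = monomHom F i ≫ ψ) : φ = ψ :=
  (isGenerating_monomHom σ F).hom_ext h

/-- Reduces an identity on `F[u] ⊗ G[v]` to one identity on `F ⊗ G` for each pair of exponents. -/
lemma poly_tensor_hom_ext {σ τ : Type} {F G H : LinFun.{w} R X}
    {φ ψ : poly σ F ⊗ poly τ G ⟶ H}
    (h : ∀ i j, (monomHom F i ⊗ₘ monomHom G j) ≫ φ = (monomHom F i ⊗ₘ monomHom G j) ≫ ψ) :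
    φ = ψ :=
  ((isGenerating_monomHom σ F).tensorHom (isGenerating_monomHom τ G)).hom_ext
    fun p => h p.1 p.2

/-- The components of `polyDesc`. -/
noncomputable def polyDescApp {σ : Type} {F G : LinFun.{w} R X} (f : (σ →₀ ℕ) → (F ⟶ G))
    (x : X) : (poly σ F).val x →ₗ[R] G.val x :=
  show ((σ →₀ ℕ) →₀ F.val x) →ₗ[R] G.val x from Finsupp.lsum R fun i => app (f i) x

lemma polyDescApp_monom {σ : Type} {F G : LinFun.{w} R X} (f : (σ →₀ ℕ) → (F ⟶ G)) (x : X)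
    (i : σ →₀ ℕ) (a : F.val x) : polyDescApp f x (monom F x i a) = app (f i) x a := by
  change (Finsupp.lsum R fun i => app (f i) x) (Finsupp.single i a) = _
  simp

/-- `F[t]` is the coproduct of the copies `F t^i` of `F`. -/
noncomputable def polyDesc {σ : Type} {F G : LinFun.{w} R X} (f : (σ →₀ ℕ) → (F ⟶ G)) :
    poly σ F ⟶ G :=
  mkHom (polyDescApp f) (fun k p => by
    induction p using poly_induction with
    | zero => simp only [map_zero]
    | add p q hp hq => simp only [map_add, hp, hq]
    | basic i a => rw [act_monom, polyDescApp_monom, polyDescApp_monom, app_act])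

lemma monomHom_polyDesc {σ : Type} {F G : LinFun.{w} R X} (f : (σ →₀ ℕ) → (F ⟶ G))
    (i : σ →₀ ℕ) : monomHom F i ≫ polyDesc f = f i :=
  LinFun.hom_ext fun x a => polyDescApp_monom f x i a

/-- The substitution of variables along a map `f` between the sets of variables. -/
noncomputable def rename {σ τ : Type} (f : σ → τ) (F : LinFun.{w} R X) :
    poly σ F ⟶ poly τ F :=
  polyDesc fun i => monomHom F (i.mapDomain f)

lemma monomHom_rename {σ τ : Type} (f : σ → τ) (F : LinFun.{w} R X) (i : σ →₀ ℕ) :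
    monomHom F i ≫ rename f F = monomHom F (i.mapDomain f) :=
  monomHom_polyDesc _ _

@[simp] lemma app_rename_monom {σ τ : Type} (f : σ → τ) (F : LinFun.{w} R X) (i : σ →₀ ℕ)
    (x : X) (a : F.val x) :
    app (rename f F) x (monom F x i a) = monom F x (i.mapDomain f) a :=
  congrArg (fun k => app k x a) (monomHom_rename f F i)

variable (A : LinFun.{w} R X) [MonObj A]

/-- The element-free form of the product of monomials. With it, identities between composites of
morphisms become identities between exponents. -/
lemma monomHom_tensorHom_mul {σ : Type} (i j : σ →₀ ℕ) :
    (monomHom A i ⊗ₘ monomHom A j) ≫ μ[poly σ A] = μ[A] ≫ monomHom A (i + j) :=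
  tensor_ext fun x y a b => by
    rw [app_comp, app_tensorHom]
    exact prod_monom σ A i j a b

lemma one_poly (σ : Type) : η[poly σ A] = η[A] ≫ monomHom A 0 :=
  LinFun.hom_ext fun x f => by
    obtain ⟨f, rfl⟩ := unitElt_surjective f
    rw [app_unitElt, app_comp, app_unitElt η[A], app_monomHom, ← act_monom]
    exact congrArg _ (unit_poly σ A)

/-- Substitution is multiplicative because `Finsupp.mapDomain` is additive in the exponent.
Injectivity of `f` plays no role, so the fold `σ ⊕ σ → σ` is covered. -/
lemma mul_rename {σ τ : Type} (f : σ → τ) :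
    μ[poly σ A] ≫ rename f A = (rename f A ⊗ₘ rename f A) ≫ μ[poly τ A] :=
  poly_tensor_hom_ext fun i j => by
    rw [reassoc_of% monomHom_tensorHom_mul A, monomHom_rename, tensorHom_comp_tensorHom_assoc,
      monomHom_rename, monomHom_rename, monomHom_tensorHom_mul, Finsupp.mapDomain_add]

lemma rename_prod {σ τ : Type} (f : σ → τ) {x y : X} (p : (poly σ A).val x)
    (q : (poly σ A).val y) :
    app (rename f A) (x ⊗ y) ((poly σ A).prod x y p q) =
      (poly τ A).prod x y (app (rename f A) x p) (app (rename f A) y q) := by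
  have := congrArg (fun k => app k _ (tens _ _ x y p q)) (mul_rename A f)
  simp only [app_comp, app_tensorHom] at this
  exact this

lemma rename_var {σ τ : Type} (f : σ → τ) (s : σ) :
    app (rename f A) _ (var A s) = var A (f s) := by
  rw [var, app_rename_monom, Finsupp.mapDomain_single, var]

/-- The product with a variable lives over `x ⊗ 𝟙_ X`, and the right unitor brings it back over `x`.
Ideals are stable under this transport, since they are subfunctors. -/
lemma monom_prod_var {σ : Type} {x : X} (i : σ →₀ ℕ) (a : A.val x) (s : σ) :
    (poly σ A).act (ρ_ x).hom ((poly σ A).prod x (𝟙_ X) (monom A x i a) (var A s)) =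
      monom A x (i + Finsupp.single s 1) a := by
  rw [var, prod_monom, prod_unit, act_monom, ← act_comp, Iso.inv_hom_id, act_id]

/-! ### The product of two polynomial monoids -/

/-- The morphism `A[u] ⊗ A[v] ⟶ A[u, v]`, `a u^i ⊗ b v^j ↦ (a × b) u^i v^j`. -/
noncomputable def polyMul (σ τ : Type) : poly σ A ⊗ poly τ A ⟶ poly (σ ⊕ τ) A :=
  (rename Sum.inl A ⊗ₘ rename Sum.inr A) ≫ μ[poly (σ ⊕ τ) A]

lemma mapDomain_inl_add_mapDomain_inr {σ τ : Type} (i : σ →₀ ℕ) (j : τ →₀ ℕ) :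
    i.mapDomain Sum.inl + j.mapDomain Sum.inr = Finsupp.sumElim i j := by
  ext (s | t)
  · rw [Finsupp.add_apply, Finsupp.mapDomain_apply Sum.inl_injective,
      Finsupp.mapDomain_of_notMem_range _ _ (by simp)]
    simp
  · rw [Finsupp.add_apply, Finsupp.mapDomain_apply Sum.inr_injective,
      Finsupp.mapDomain_of_notMem_range _ _ (by simp)]
    simp

/-- On each pair of monomials `polyMul` is `μ[A]`, and distinct pairs land in distinct exponents.
Both the invertibility of `polyMul` and the formula for `Φ` rest on this. -/
lemma monomHom_tensorHom_polyMul {σ τ : Type} (i : σ →₀ ℕ) (j : τ →₀ ℕ) :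
    (monomHom A i ⊗ₘ monomHom A j) ≫ polyMul A σ τ = μ[A] ≫ monomHom A (Finsupp.sumElim i j) := by
  rw [polyMul, tensorHom_comp_tensorHom_assoc, monomHom_rename, monomHom_rename,
    monomHom_tensorHom_mul, mapDomain_inl_add_mapDomain_inr]

/-- If `A` is tensor idempotent, then `A[u] ⊗ A[v]` is isomorphic to `A[u, v]`. -/
noncomputable def polyMulIso (σ τ : Type) [IsIso μ[A]] :
    poly σ A ⊗ poly τ A ≅ poly (σ ⊕ τ) A where
  hom := polyMul A σ τ
  -- On the copy of `A` with exponent `k`, undo `μ[A]` and distribute the `inl` and `inr` parts of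
  -- `k` over the two factors.
  inv := polyDesc fun k => inv μ[A] ≫
    (monomHom A (k.comapDomain Sum.inl Sum.inl_injective.injOn) ⊗ₘ
      monomHom A (k.comapDomain Sum.inr Sum.inr_injective.injOn))
  hom_inv_id := poly_tensor_hom_ext fun i j => by
    rw [reassoc_of% monomHom_tensorHom_polyMul A, monomHom_polyDesc, IsIso.hom_inv_id_assoc,
      Finsupp.comapDomain_inl_sumElim, Finsupp.comapDomain_inr_sumElim, Category.comp_id]
  inv_hom_id := poly_hom_ext fun k => by
    rw [reassoc_of% @monomHom_polyDesc, Category.assoc, monomHom_tensorHom_polyMul,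
      IsIso.inv_hom_id_assoc, Finsupp.comapDomain_sumElim_comapDomain, Category.comp_id]

/-- Folding the exponent of `u^i v^j` gives `i + j`, the exponent of the product in `A[t]`. This
turns the kernel of `μ` into the kernel of a substitution. -/
lemma polyMul_rename_fold (σ : Type) :
    polyMul A σ σ ≫ rename (Sum.elim id id) A = μ[poly σ A] :=
  poly_tensor_hom_ext fun i j => by
    rw [reassoc_of% monomHom_tensorHom_polyMul A, monomHom_rename, monomHom_tensorHom_mul,
      ← mapDomain_inl_add_mapDomain_inr, Finsupp.mapDomain_add, ← Finsupp.mapDomain_comp,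
      ← Finsupp.mapDomain_comp, Sum.elim_comp_inl, Sum.elim_comp_inr, Finsupp.mapDomain_id,
      Finsupp.mapDomain_id]

/-! ### The ideal generated by the differences of the variables -/

/-- Modulo such an ideal, every `v_l` occurring in the exponent `k` can be replaced by `u_l`. The
exponent `i` is a spectator: it is left arbitrary so that the induction can move factors into it. -/
lemma monom_sub_monom_mem {σ : Type} {S : Sub (poly (σ ⊕ σ) A)} (hS : S.IsIdeal)
    (h : ∀ l : σ, var A (Sum.inl l) - var A (Sum.inr l) ∈ S.carrier (𝟙_ X)) {x : X}
    (a : A.val x) (i k : σ ⊕ σ →₀ ℕ) :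
    monom A x (i + k) a - monom A x (i + (k.mapDomain (Sum.elim id id)).mapDomain Sum.inl) a ∈
      S.carrier x := by
  induction k using Finsupp.induction_linear generalizing i with
  | zero => simp
  | add k k' hk hk' =>
    -- Insert the monomial in which only `k` has been replaced. The spectator is `i + k'` for the
    -- first difference, and `i` plus the replaced `k` for the second.
    rw [Finsupp.mapDomain_add, Finsupp.mapDomain_add, ← add_assoc i (Finsupp.mapDomain _ _),
      show i + (k + k') = i + k' + k by abel,
      ← sub_add_sub_cancel _
        (monom A x (i + k' + (k.mapDomain (Sum.elim id id)).mapDomain Sum.inl) a)]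
    refine add_mem (hk _) ?_
    rw [add_right_comm]
    exact hk' _
  | single s c =>
    rw [Finsupp.mapDomain_single, Finsupp.mapDomain_single]
    induction c generalizing i with
    | zero => simp
    | succ c hc =>
      rcases s with l | l
      -- A power of `u_l` is left unchanged by the replacement, so the difference is zero.
      · simp
      -- With `u = u_l` and `v = v_l`, this is `v^(c+1) - u^(c+1) = u (v^c - u^c) - v^c (u - v)`,
      -- multiplied by the monomial `a t^i`. Here `h₁` is the term with `u - v`, and `h₂` is the
      -- induction hypothesis with `u` absorbed into the spectator.
      · have h₁ := S.act_mem (ρ_ x).hom (hS (monom A x (i + Finsupp.single (Sum.inr l) c) a) (h l))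
        rw [map_sub, map_sub, monom_prod_var, monom_prod_var] at h₁
        have h₂ := hc (i + Finsupp.single (Sum.inl l) 1)
        simp only [Sum.elim_inr, id] at h₂ ⊢
        rw [add_right_comm] at h₂
        have := sub_mem h₂ h₁
        rwa [sub_sub_sub_cancel_left, add_assoc, add_right_comm, add_assoc, ← Finsupp.single_add,
          ← Finsupp.single_add] at this

/-- The span is handled as an intersection of ideals, so no explicit form of its elements is needed:
one inclusion is a congruence modulo an arbitrary ideal in the intersection, the other exhibits the
kernel as one of these ideals. -/
lemma ker_rename_fold_eq_span (σ : Type) :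
    Sub.ker (rename (Sum.elim id id) A) =
      Sub.span (poly (σ ⊕ σ) A) (fun l : σ => var A (Sum.inl l) - var A (Sum.inr l)) := by
  ext x p
  change app _ x p = 0 ↔ p ∈ ⨅ (S : Sub (poly (σ ⊕ σ) A)) (_ : S.IsIdeal) (_ : ∀ l, _), _
  simp only [Submodule.mem_iInf]
  constructor
  · intro hp S hS h
    -- Stated for all `p`, because being in the kernel does not pass to the monomials of `p` and
    -- would block the induction.
    have key (p : (poly (σ ⊕ σ) A).val x) :
        p - app (rename Sum.inl A) x (app (rename (Sum.elim id id) A) x p) ∈ S.carrier x := by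
      induction p using poly_induction with
      | zero => simp
      | add p q hp hq =>
        rw [map_add, map_add, add_sub_add_comm]
        exact add_mem hp hq
      | basic i a =>
        rw [app_rename_monom, app_rename_monom]
        simpa only [zero_add] using monom_sub_monom_mem A hS h a 0 i
    simpa only [hp, map_zero, sub_zero] using key p
  · intro hp
    -- The kernel is an ideal because the fold is multiplicative, and it contains the generators
    -- because the fold identifies `u_l` with `v_l`.
    refine hp (Sub.ker (rename (Sum.elim id id) A)) (fun x y a s hs => ?_) fun l => ?_
    · change app _ _ _ = 0
      have hs : app (rename (Sum.elim id id) A) _ s = 0 := hs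
      rw [rename_prod, hs, map_zero]
    · change app _ _ _ = 0
      rw [map_sub, rename_var, rename_var, Sum.elim_inl, Sum.elim_inr, sub_self]

end Poly

/-! ### Compatibility of `polyMul` with the monoid structures -/

section Commutative

variable {R : Type r} [CommRing R] {X : Type u} [Category.{v} X] [Preadditive X] [Linear R X]
  [MonoidalCategory X] [MonoidalPreadditive X] [MonoidalLinear R X] [SymmetricCategory X]
  [EssentiallySmall.{w} X] (A : LinFun.{w} R X) [MonObj A]

lemma one_polyMul (σ τ : Type) :
    η[poly σ A ⊗ poly τ A] ≫ polyMul A σ τ = η[poly (σ ⊕ τ) A] := by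
  -- This is `ε × ε = ε`. The unit of the tensor product is built from two units, each a constant
  -- polynomial, so only this remains.
  have h : (λ_ (𝟙_ (LinFun.{w} R X))).inv ≫ (η[A] ⊗ₘ η[A]) ≫ μ[A] = η[A] := by
    simp [MonoidalCategory.tensorHom_def']
  rw [MonObj.tensorObj.one_def, one_poly, one_poly, one_poly, ← tensorHom_comp_tensorHom,
    Category.assoc, Category.assoc, monomHom_tensorHom_polyMul, Finsupp.sumElim_zero_zero]
  simp only [← Category.assoc] at h ⊢
  rw [h]

/-- On four monomials both sides are morphisms from `(A ⊗ A) ⊗ (A ⊗ A)` followed by the same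
monomial inclusion. They differ only by exchanging the two middle factors before multiplying, which
commutativity of `A` makes harmless. -/
lemma mul_polyMul (σ τ : Type) [IsCommMonObj A] :
    μ[poly σ A ⊗ poly τ A] ≫ polyMul A σ τ =
      (polyMul A σ τ ⊗ₘ polyMul A σ τ) ≫ μ[poly (σ ⊕ τ) A] := by
  refine (((isGenerating_monomHom σ A).tensorHom (isGenerating_monomHom τ A)).tensorHom
    ((isGenerating_monomHom σ A).tensorHom (isGenerating_monomHom τ A))).hom_ext
    fun ⟨⟨i, j⟩, ⟨k, l⟩⟩ => ?_
  -- Naturality of `tensorμ`, the exchange of the middle factors, lets the monomial inclusions pass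
  -- through it, leaving an identity about `A` alone.
  rw [MonObj.tensorObj.mul_def, Category.assoc, tensorμ_natural_assoc,
    tensorHom_comp_tensorHom_assoc, monomHom_tensorHom_mul, monomHom_tensorHom_mul,
    ← tensorHom_comp_tensorHom_assoc, monomHom_tensorHom_polyMul,
    tensorHom_comp_tensorHom_assoc, monomHom_tensorHom_polyMul, monomHom_tensorHom_polyMul,
    ← tensorHom_comp_tensorHom_assoc, monomHom_tensorHom_mul,
    MonObj.mul_mul_mul_comm_assoc, Finsupp.sumElim_add]

end Commutative

end LinFun

/-! ### The isomorphism of monoids and the image of the kernel -/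

theorem proposition4p5 {R : Type r} [CommRing R] {X : Type u} [Category.{v} X] [Preadditive X]
    [Linear R X] [MonoidalCategory X] [MonoidalPreadditive X] [MonoidalLinear R X]
    [SymmetricCategory X] [EssentiallySmall.{w} X]
    (A : LinFun.{w} R X) [MonObj A] [IsCommMonObj A] (hA : IsIso μ[A]) (n : ℕ) :
    ∃ Φ : Mon.mk (LinFun.poly (Fin n) A ⊗ LinFun.poly (Fin n) A) ≅
        Mon.mk (LinFun.poly (Fin n ⊕ Fin n) A),
      (∀ (x y : X) (i j : Fin n →₀ ℕ) (a : A.val x) (b : A.val y),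
        LinFun.app Φ.hom.hom (x ⊗ y)
            (LinFun.tens (LinFun.poly (Fin n) A) (LinFun.poly (Fin n) A) x y
              (LinFun.monom A x i a) (LinFun.monom A y j b)) =
          LinFun.monom A (x ⊗ y) (Finsupp.sumElim i j) (A.prod x y a b)) ∧
      LinFun.Sub.map Φ.hom.hom (LinFun.Sub.ker μ[LinFun.poly (Fin n) A]) =
        LinFun.Sub.span (LinFun.poly (Fin n ⊕ Fin n) A)
          (fun l : Fin n => LinFun.var A (Sum.inl l) - LinFun.var A (Sum.inr l)) := by
  let Φ : Mon.mk (LinFun.poly (Fin n) A ⊗ LinFun.poly (Fin n) A) ≅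
      Mon.mk (LinFun.poly (Fin n ⊕ Fin n) A) :=
    Mon.mkIso (LinFun.polyMulIso A (Fin n) (Fin n)) (LinFun.one_polyMul A _ _)
      (LinFun.mul_polyMul A _ _)
  refine ⟨Φ, fun x y i j a b => ?_, ?_⟩
  · have := congrArg (fun k => LinFun.app k _ (LinFun.tens _ _ x y a b))
      (LinFun.monomHom_tensorHom_polyMul A i j)
    simp only [LinFun.app_comp, LinFun.app_tensorHom] at this
    exact this
  -- The claim becomes that `Φ` maps the kernel of `Φ` followed by the fold onto the kernel of the
  -- fold. The forward inclusion is immediate; the other needs a preimage under `Φ`, supplied by its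
  -- inverse.
  · rw [← LinFun.ker_rename_fold_eq_span, ← LinFun.polyMul_rename_fold]
    ext x p
    constructor
    · rintro ⟨q, hq, rfl⟩
      exact hq
    · intro hp
      have hq : LinFun.app (LinFun.polyMul A (Fin n) (Fin n)) x
          (LinFun.app (LinFun.polyMulIso A (Fin n) (Fin n)).inv x p) = p :=
        congrArg (fun k => LinFun.app k x p) (LinFun.polyMulIso A (Fin n) (Fin n)).inv_hom_id
      refine ⟨_, ?_, hq⟩
      change LinFun.app (LinFun.rename _ A) x (LinFun.app (LinFun.polyMul A _ _) x _) = 0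
      rw [hq]
      exact hp
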